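/- Let roadside units (RSUs) form a homogeneous Poisson point process of density $\lambda_{\rm r}>0$ on $\mathbb{R}$, and let every RSU be active independently with probability $\mathrm{p}\in(0,1]$, so that the active RSUs form a Poisson point process $\Phi_{\rm a}$ of density $\mathrm{p}\lambda_{\rm r}$. A vehicle at the origin is served by its nearest RSU, at distance $R$, whose density is $f_R(r)=2\lambda_{\rm r}e^{-2\lambda_{\rm r}r}$, $r>0$. Let $\alpha>1$ be the path-loss exponent, $P_{\rm t}>0$ the transmit power, $\sigma^2>0$ the noise power and $\mathrm{SNR}=P_{\rm t}/\sigma^2$. Let $$\mathrm{SINR}=\frac{H P_{\rm t}R^{-\alpha}}{I+\sigma^2},\qquad I=\sum_{z_i\in\Phi_{\rm a},\,|z_i|>R}H_iP_{\rm t}|z_i|^{-\alpha},$$ where the fading gains $H,H_1,H_2,\dots$ are independent exponential random variables of mean $1$, independent of the locations and the activity of the RSUs. For $\tau>0$ let $P_c(\tau)=\mathbb{P}[\mathrm{SINR}>\tau\mid R,\Phi_{\rm a}]$ be the conditional coverage probability. Then for every $x>0$ its meta distribution is $$\mathbb{P}[P_c(\tau)>x]=\frac12-\frac1\pi\int_0^\infty\frac1t\int_0^\infty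 f_{\rm r}(t,r)\,\sin\bigl(f_{\rm i}(t,r)+\Theta(t,r)\bigr)\,f_R(r)\,dr\,dt,$$ where, with $\eta=1+1/\alpha$, $$f_{\rm r}(t,r)=\exp\Bigl(-\frac{2\mathrm{p}\lambda_{\rm r}r}{\alpha}\int_0^1\bigl(1-\cos(t\ln(1+\tau y))\bigr)y^{-\eta}\,dy\Bigr),$$ $$f_{\rm i}(t,r)=\frac{2\mathrm{p}\lambda_{\rm r}r}{\alpha}\int_0^1\sin(t\ln(1+\tau y))\,y^{-\eta}\,dy,\qquad \Theta(t,r)=\frac{t\tau r^\alpha}{\mathrm{SNR}}+t\ln x,$$ and all these integrals converge absolutely. -/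

import Mathlib

open MeasureTheory ProbabilityTheory Set
open scoped ENNReal NNReal

noncomputable section

namespace RSUCoverage

/-! ### Poisson point processes -/

/-- A random measure `N` on `E` is a Poisson point process with intensity measure `Λ`: the number
of points in a set of finite intensity is Poisson distributed with mean `Λ B`, and the numbers of
points in finitely many pairwise disjoint sets are independent. -/
structure IsPoissonPointProcess {Ω E : Type*} [MeasurableSpace Ω] [MeasurableSpace E]
    (μ : Measure Ω) (N : Ω → Measure E) (Λ : Measure E) : Prop where
  measurable : Measurable N
  law_count : ∀ B : Set E, MeasurableSet B → Λ B < ∞ →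
    μ.map (fun ω => N ω B) = (poissonMeasure (Λ B).toNNReal).map (fun k : ℕ => (k : ℝ≥0∞))
  indep_count : ∀ (n : ℕ) (B : Fin n → Set E), (∀ i, MeasurableSet (B i)) →
    Pairwise (fun i j => Disjoint (B i) (B j)) → iIndepFun (fun i ω => N ω (B i)) μ

/-! ### The network seen from the typical vehicle, located at the origin of the road `ℝ` -/

section Model

variable {Ω : Type*}

/-- The point process of all RSUs, as a counting measure; `z i` is the location of RSU `i`. -/
def rsuProcess (z : ℕ → Ω → ℝ) (ω : Ω) : Measure ℝ :=
  Measure.sum (fun i => Measure.dirac (z i ω))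

/-- The point process of the active RSUs, as a counting measure; `act i` tells whether RSU `i`
is active. -/
def activeProcess (z : ℕ → Ω → ℝ) (act : ℕ → Ω → Bool) (ω : Ω) : Measure ℝ :=
  Measure.sum (fun i => if act i ω = true then Measure.dirac (z i ω) else 0)

/-- Distance from the typical vehicle to the RSU that serves it, the closest one. -/
def servingDist (z : ℕ → Ω → ℝ) (ω : Ω) : ℝ := ⨅ i, |z i ω|

/-- Interference at the typical vehicle: total received power from the active RSUs that are
farther away than the serving RSU. `G i` is the fading gain of the link from RSU `i`, `Pt` the
transmit power, `α` the path-loss exponent. -/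
def interference (α Pt : ℝ) (z : ℕ → Ω → ℝ) (act : ℕ → Ω → Bool) (G : ℕ → Ω → ℝ) (ω : Ω) :
    ℝ≥0∞ :=
  ∑' i, if act i ω = true ∧ servingDist z ω < |z i ω| then
    ENNReal.ofReal (G i ω * Pt * |z i ω| ^ (-α)) else 0

/-- Signal-to-interference-plus-noise ratio at the typical vehicle. `H` is the fading gain of the
serving link, `noise` the noise power. -/
def SINR (α Pt noise : ℝ) (z : ℕ → Ω → ℝ) (act : ℕ → Ω → Bool) (H : Ω → ℝ) (G : ℕ → Ω → ℝ)
    (ω : Ω) : ℝ≥0∞ :=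
  ENNReal.ofReal (H ω * Pt * servingDist z ω ^ (-α)) /
    (interference α Pt z act G ω + ENNReal.ofReal noise)

/-- The sigma-algebra of the network realization: it is generated by the distance to the serving
RSU and by the point process of active RSUs. The fading is not part of it. -/
abbrev realization (z : ℕ → Ω → ℝ) (act : ℕ → Ω → Bool) : MeasurableSpace Ω :=
  MeasurableSpace.comap (servingDist z) inferInstance ⊔
    MeasurableSpace.comap (activeProcess z act) inferInstance

variable [MeasurableSpace Ω]

/-- The stochastic model. RSUs form a homogeneous Poisson point process of density `lam` on the
line; every RSU is active with probability `p`, independently of everything else, so that the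
active RSUs form a Poisson point process of density `p * lam`; all links have independent Rayleigh
fading, i.e. exponential power gains of mean one. -/
structure IsNetwork (μ : Measure Ω) (lam p : ℝ) (z : ℕ → Ω → ℝ) (act : ℕ → Ω → Bool)
    (H : Ω → ℝ) (G : ℕ → Ω → ℝ) : Prop where
  measurable_loc : ∀ i, Measurable (z i)
  measurable_act : ∀ i, Measurable (act i)
  measurable_serving_gain : Measurable H
  measurable_gain : ∀ i, Measurable (G i)
  poisson : IsPoissonPointProcess μ (rsuProcess z) (ENNReal.ofReal lam • (volume : Measure ℝ))
  act_prob : ∀ i, μ {ω | act i ω = true} = ENNReal.ofReal p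
  serving_gain_law : μ.map H = expMeasure 1
  gain_law : ∀ i, μ.map (G i) = expMeasure 1
  indep_act : iIndepFun act μ
  indep_gain : iIndepFun (fun o : Option ℕ => o.elim H G) μ
  indep_act_gain : IndepFun (fun ω i => act i ω) (fun ω => (H ω, fun i => G i ω)) μ
  indep_loc_marks : IndepFun (fun ω i => z i ω)
    (fun ω => ((fun i => act i ω), (H ω, fun i => G i ω))) μ

/-- The conditional coverage probability `P_c(τ) = P[SINR > τ | network realization]`, a random
variable. -/
def condCoverage (μ : Measure Ω) (α Pt noise τ : ℝ) (z : ℕ → Ω → ℝ) (act : ℕ → Ω → Bool)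
    (H : Ω → ℝ) (G : ℕ → Ω → ℝ) : Ω → ℝ :=
  μ[{ω | ENNReal.ofReal τ < SINR α Pt noise z act H G ω}.indicator (fun _ => (1 : ℝ)) |
    realization z act]

/-- The meta distribution of the coverage probability: `x ↦ P[P_c(τ) > x]`. -/
def metaDistribution (μ : Measure Ω) (α Pt noise τ : ℝ) (z : ℕ → Ω → ℝ) (act : ℕ → Ω → Bool)
    (H : Ω → ℝ) (G : ℕ → Ω → ℝ) (x : ℝ) : ℝ :=
  μ.real {ω | x < condCoverage μ α Pt noise τ z act H G ω}

end Model

/-! ### The functions in the inversion formula -/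

/-- The exponent `η = 1 + 1/α`. -/
def eta (α : ℝ) : ℝ := 1 + 1 / α

/-- The density `f_R` of the serving distance, on `r > 0`. -/
def fR (lam r : ℝ) : ℝ := 2 * lam * Real.exp (-(2 * lam * r))

/-- The integrand of the integral in `f_r`. -/
def cosKernel (α τ t y : ℝ) : ℝ := (1 - Real.cos (t * Real.log (1 + τ * y))) * y ^ (-eta α)

/-- The integrand of the integral in `f_i`. -/
def sinKernel (α τ t y : ℝ) : ℝ := Real.sin (t * Real.log (1 + τ * y)) * y ^ (-eta α)

/-- The function `f_r`. -/
def fr (lam p α τ t r : ℝ) : ℝ :=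
  Real.exp (-(2 * p * lam * r / α) * ∫ y in (0 : ℝ)..1, cosKernel α τ t y)

/-- The function `f_i`. -/
def fi (lam p α τ t r : ℝ) : ℝ :=
  (2 * p * lam * r / α) * ∫ y in (0 : ℝ)..1, sinKernel α τ t y

/-- The function `Θ`. -/
def Theta (α τ SNR x t r : ℝ) : ℝ := t * τ * r ^ α / SNR + t * Real.log x

/-- The integrand of the inner integral, over the serving distance `r`. -/
def innerIntegrand (lam p α τ SNR x t r : ℝ) : ℝ :=
  fr lam p α τ t r * Real.sin (fi lam p α τ t r + Theta α τ SNR x t r) * fR lam r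

/-- The integrand of the outer integral, over `t`. -/
def outerIntegrand (lam p α τ SNR x t : ℝ) : ℝ :=
  (∫ r in Ioi (0 : ℝ), innerIntegrand lam p α τ SNR x t r) / t

end RSUCoverage

end

/-! Given the locations and activities, Rayleigh fading makes the coverage event `H > τ R^α (I + σ²)
/ Pt` exponentially likely. Averaging over the interfering gains, each with Laplace transform `1 /
(1 + s)`, gives `P_c = exp(-τ R^α / SNR) ∏ (1 + τ (R/|z|)^α)⁻¹` over the active points beyond `R`.
This depends only on the realization, so it is the conditional probability (`condCoverage_ae_eq`).
Hence `P_c > x` means `Y < 0`, where `Y = log (x / P_c)` (`logRatio`) is a noise term plus a shot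
noise of the active points plus `log x`.

The law of `Y` is read off its characteristic function. The probability generating functional of a
Poisson process, with activity marks averaged out, gives the shot noise on the event `s ≤ R`.
Scaling by the serving distance and substituting `u = (R/|z|)^α` yields `E[exp(it · shot noise) | R
= r] = f_r exp(i f_i)`. Conditioning on the null event `R = r` is avoided: on a cell `s ≤ R < r`,
only the loss beyond the upper endpoint `r` is considered; there the factorization is exact, and the
mesh is then refined (`integral_gridAbove`, `integral_mul_exp_logLoss`).

Gil-Pelaez inversion (`integral_integral_sin_div`) then gives the formula, provided that `Y` has no
atom at `0` and the `t`-integral converges absolutely. Both rest on the same estimate: the exponent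
of `f_r` grows at least like `r t^(1/α)` (`exists_le_integral_cosKernel`), so averaging over the
exponential `R` leaves `O(t^(-1/α))`, integrable against `dt/t` at infinity. Near `t = 0` the bound
`|sin u| ≤ |u|` suffices. -/

noncomputable section

namespace RSUCoverage

open Filter Topology

/-! ### Gil-Pelaez inversion and absence of an atom at zero. -/

section Inversion

lemma integrableOn_exp_neg_mul {a : ℝ} (ha : 0 < a) :
    IntegrableOn (fun t : ℝ => Real.exp (-(a * t))) (Ioi 0) := by
  simpa using integrableOn_exp_mul_Ioi (a := -a) (by simpa) 0

lemma integrableOn_exp_mul_ofReal {a : ℝ} (ha : 0 < a) (y : ℝ) :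
    IntegrableOn (fun t : ℝ => Complex.exp ((-a + y * Complex.I) * t)) (Ioi 0) :=
  integrableOn_exp_mul_complex_Ioi (by simpa) 0

lemma integral_exp_mul_ofReal {a : ℝ} (ha : 0 < a) (y : ℝ) :
    ∫ t in Ioi (0 : ℝ), Complex.exp ((-a + y * Complex.I) * t) = 1 / (a - y * Complex.I) := by
  rw [integral_exp_mul_complex_Ioi (by simpa)]
  have h : (a - y * Complex.I : ℂ) ≠ 0 := by
    intro h; have := congrArg Complex.re h; simp at this; exact ha.ne' this
  have h' : (-a + y * Complex.I : ℂ) ≠ 0 := by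
    intro h; have := congrArg Complex.re h; simp at this; exact ha.ne' this
  simp only [Complex.ofReal_zero, mul_zero, Complex.exp_zero]
  field_simp
  ring

lemma exp_mul_ofReal_eq (a y t : ℝ) : Complex.exp ((-a + y * Complex.I) * t) =
    Real.exp (-(a * t)) * Complex.exp ((t * y : ℝ) * Complex.I) := by
  rw [Complex.ofReal_exp, ← Complex.exp_add]; congr 1; push_cast; ring

lemma integral_exp_neg_mul_sin {a : ℝ} (ha : 0 < a) (y : ℝ) :
    ∫ t in Ioi (0 : ℝ), Real.exp (-(a * t)) * Real.sin (t * y) = y / (a ^ 2 + y ^ 2) := by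
  have h := congrArg Complex.im (integral_exp_mul_ofReal ha y)
  rw [← RCLike.im_eq_complex_im, ← integral_im (integrableOn_exp_mul_ofReal ha y)] at h
  simp only [exp_mul_ofReal_eq] at h
  rw [RCLike.im_eq_complex_im] at h
  simp only [Complex.im_ofReal_mul, Complex.exp_ofReal_mul_I_im] at h
  rw [h]
  simp [Complex.normSq_apply]
  ring

lemma integral_exp_neg_mul_cos {a : ℝ} (ha : 0 < a) (y : ℝ) :
    ∫ t in Ioi (0 : ℝ), Real.exp (-(a * t)) * Real.cos (t * y) = a / (a ^ 2 + y ^ 2) := by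
  have h := congrArg Complex.re (integral_exp_mul_ofReal ha y)
  rw [← RCLike.re_eq_complex_re, ← integral_re (integrableOn_exp_mul_ofReal ha y)] at h
  simp only [exp_mul_ofReal_eq] at h
  rw [RCLike.re_eq_complex_re] at h
  simp only [Complex.re_ofReal_mul, Complex.exp_ofReal_mul_I_re] at h
  rw [h]
  simp [Complex.normSq_apply]
  ring

/-- A bounded approximation of `1 / t`. -/
def dampedInv (a b t : ℝ) : ℝ := (Real.exp (-(a * t)) - Real.exp (-(b * t))) / t

lemma integral_exp_neg_mul_interval (a b : ℝ) {t : ℝ} (ht : t ≠ 0) :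
    ∫ s in a..b, Real.exp (-(s * t)) = dampedInv a b t := by
  have h : ∀ s ∈ uIcc a b,
      HasDerivAt (fun s => -Real.exp (-(s * t)) / t) (Real.exp (-(s * t))) s := by
    intro s _
    have h1 : HasDerivAt (fun s : ℝ => -(s * t)) (-t) s := by
      have := ((hasDerivAt_id s).mul_const t).neg
      rw [one_mul] at this
      exact this
    refine (h1.exp.neg.div_const t).congr_deriv ?_
    field_simp
  rw [intervalIntegral.integral_eq_sub_of_hasDerivAt h
    ((by fun_prop : Continuous fun s => Real.exp (-(s * t))).intervalIntegrable _ _), dampedInv]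
  ring

lemma dampedInv_nonneg {a b : ℝ} (hab : a ≤ b) {t : ℝ} (ht : 0 < t) : 0 ≤ dampedInv a b t := by
  refine div_nonneg (sub_nonneg.2 (Real.exp_le_exp.2 ?_)) ht.le
  nlinarith

lemma dampedInv_le_exp (a b : ℝ) {t : ℝ} (ht : 0 < t) :
    dampedInv a b t ≤ (b - a) * Real.exp (-(a * t)) := by
  rw [dampedInv, div_le_iff₀ ht]
  have h := Real.add_one_le_exp (-((b - a) * t))
  have h2 : Real.exp (-(b * t)) = Real.exp (-(a * t)) * Real.exp (-((b - a) * t)) := by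
    rw [← Real.exp_add]; ring_nf
  rw [h2]
  nlinarith [Real.exp_pos (-(a * t))]

lemma dampedInv_le_inv {a b : ℝ} (ha : 0 ≤ a) {t : ℝ} (ht : 0 < t) : dampedInv a b t ≤ 1 / t := by
  refine div_le_div_of_nonneg_right ?_ ht.le
  have : Real.exp (-(a * t)) ≤ 1 := Real.exp_le_one_iff.2 (by nlinarith)
  linarith [Real.exp_pos (-(b * t))]

lemma measurable_dampedInv (a b : ℝ) : Measurable (dampedInv a b) := by
  unfold dampedInv; fun_prop

lemma integrableOn_dampedInv {a b : ℝ} (ha : 0 < a) (hab : a ≤ b) :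
    IntegrableOn (dampedInv a b) (Ioi 0) := by
  refine ((integrableOn_exp_neg_mul ha).const_mul (b - a)).mono'
    (measurable_dampedInv a b).aestronglyMeasurable ?_
  filter_upwards [ae_restrict_mem measurableSet_Ioi] with t ht
  rw [Real.norm_of_nonneg (dampedInv_nonneg hab ht)]
  exact dampedInv_le_exp a b ht

lemma integral_div_sq_add_sq {a b : ℝ} (ha : 0 < a) (hab : a ≤ b) (y : ℝ) :
    ∫ s in a..b, y / (s ^ 2 + y ^ 2) = Real.arctan (y / a) - Real.arctan (y / b) := by
  have hpos : ∀ s ∈ uIcc a b, 0 < s := fun s hs => ha.trans_le (uIcc_of_le hab ▸ hs).1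
  have h : ∀ s ∈ uIcc a b,
      HasDerivAt (fun s => -Real.arctan (y / s)) (y / (s ^ 2 + y ^ 2)) s := by
    intro s hs
    have hs := hpos s hs
    have h1 : HasDerivAt (fun s : ℝ => y / s) (y * (-(s ^ 2)⁻¹)) s := by
      simpa [div_eq_mul_inv] using (hasDerivAt_inv hs.ne').const_mul y
    refine h1.arctan.neg.congr_deriv ?_
    have : s ^ 2 + y ^ 2 ≠ 0 := by positivity
    have : 1 + (y / s) ^ 2 ≠ 0 := by positivity
    field_simp
  rw [intervalIntegral.integral_eq_sub_of_hasDerivAt h]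
  · ring
  · refine ContinuousOn.intervalIntegrable ?_
    refine ContinuousOn.div (by fun_prop) (by fun_prop) fun s hs => ?_
    have := hpos s hs
    positivity

/-- Since `dampedInv a b t` is the integral of `exp (-(s * t))` over `s` in `[a, b]`, Fubini reduces
the claim to the Laplace transform of the sine, `y / (s² + y²)`, integrated in `s`. On the product
domain `exp (-(a * t))` dominates. -/
lemma integral_dampedInv_mul_sin {a b : ℝ} (ha : 0 < a) (hab : a ≤ b) (y : ℝ) :
    ∫ t in Ioi (0 : ℝ), dampedInv a b t * Real.sin (t * y) =
      Real.arctan (y / a) - Real.arctan (y / b) := by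
  have h1 : ∫ t in Ioi (0 : ℝ), dampedInv a b t * Real.sin (t * y) =
      ∫ t in Ioi (0 : ℝ), ∫ s in Ioc a b, Real.exp (-(s * t)) * Real.sin (t * y) := by
    refine setIntegral_congr_fun measurableSet_Ioi fun t ht => ?_
    rw [integral_mul_const, ← intervalIntegral.integral_of_le hab,
      integral_exp_neg_mul_interval a b (ne_of_gt ht)]
  rw [h1, integral_integral_swap, ← integral_div_sq_add_sq ha hab,
    intervalIntegral.integral_of_le hab]
  · refine setIntegral_congr_fun measurableSet_Ioc fun s hs => ?_
    exact integral_exp_neg_mul_sin (ha.trans hs.1) y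
  · have hg : Integrable (Function.uncurry fun (t s : ℝ) => Real.exp (-(a * t)) * (1 : ℝ))
        ((volume.restrict (Ioi 0)).prod (volume.restrict (Ioc a b))) :=
      (integrableOn_exp_neg_mul ha).mul_prod (integrable_const 1)
    refine hg.mono' (by fun_prop) ?_
    rw [Measure.prod_restrict]
    filter_upwards [ae_restrict_mem (measurableSet_Ioi.prod measurableSet_Ioc)] with q hq
    obtain ⟨hq1, hq2⟩ := hq
    simp only [mem_Ioi, mem_Ioc] at hq1 hq2
    simp only [Function.uncurry, norm_mul, Real.norm_eq_abs, Real.abs_exp, mul_one]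
    calc Real.exp (-(q.2 * q.1)) * |Real.sin (q.1 * y)| ≤ Real.exp (-(q.2 * q.1)) * 1 := by
          gcongr; exact Real.abs_sin_le_one _
      _ ≤ Real.exp (-(a * q.1)) := by
          rw [mul_one]; refine Real.exp_le_exp.2 ?_; nlinarith [hq2.1]

variable {Ω : Type*} [MeasurableSpace Ω] {μ : Measure Ω} [IsProbabilityMeasure μ]

/-- Fubini for an integrable kernel and a bounded `f`. It serves with the sine for the inversion
formula and with the cosine for the atom at `0`. -/
lemma integral_mul_integral_comp {k : ℝ → ℝ} (hk : IntegrableOn k (Ioi 0)) {Y : Ω → ℝ}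
    (hY : Measurable Y) {f : ℝ → ℝ} (hf : Measurable f) (hf1 : ∀ x, |f x| ≤ 1) :
    ∫ t in Ioi (0 : ℝ), k t * ∫ ω, f (t * Y ω) ∂μ =
      ∫ ω, (∫ t in Ioi (0 : ℝ), k t * f (t * Y ω)) ∂μ := by
  simp_rw [← integral_const_mul]
  rw [integral_integral_swap]
  have hg : Integrable (Function.uncurry fun (t : ℝ) (_ : Ω) => k t * (1 : ℝ))
      ((volume.restrict (Ioi 0)).prod μ) := Integrable.mul_prod hk (integrable_const 1)
  refine hg.mono ?_ (ae_of_all _ fun q => ?_)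
  · refine AEStronglyMeasurable.mul ?_ (Measurable.aestronglyMeasurable (by fun_prop))
    exact hk.aestronglyMeasurable.comp_fst
  · simp only [Function.uncurry, norm_mul]
    gcongr
    simpa using hf1 _

/-- Gil-Pelaez inversion. -/
lemma integral_integral_sin_div {Y : Ω → ℝ} (hY : Measurable Y) (h0 : μ {ω | Y ω = 0} = 0)
    (hint : IntegrableOn (fun t => (∫ ω, Real.sin (t * Y ω) ∂μ) / t) (Ioi 0)) :
    ∫ t in Ioi (0 : ℝ), (∫ ω, Real.sin (t * Y ω) ∂μ) / t =
      Real.pi / 2 * (1 - 2 * μ.real {ω | Y ω < 0}) := by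
  have hM : ∀ n : ℕ, (0 : ℝ) < n + 2 := fun n => by positivity
  have hMtop : Tendsto (fun n : ℕ => (n : ℝ) + 2) atTop atTop :=
    tendsto_atTop_add_const_right _ _ tendsto_natCast_atTop_atTop
  have hM0 : Tendsto (fun n : ℕ => ((n : ℝ) + 2)⁻¹) atTop (𝓝 0) := hMtop.inv_tendsto_atTop
  have hle : ∀ n : ℕ, ((n : ℝ) + 2)⁻¹ ≤ n + 2 := fun n => by
    have h2 : (1 : ℝ) ≤ n + 2 := by have : (0 : ℝ) ≤ n := n.cast_nonneg
                                    linarith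
    exact (inv_le_one_of_one_le₀ h2).trans h2
  -- These kernels lie between `0` and `1 / t` and tend to `1 / t`, so `hint` provides domination on
  -- the `t` side. On the `ω` side they give differences of arctangents, bounded by `π`, which tend
  -- to `π / 2` times the sign of `Y`.
  set k : ℕ → ℝ → ℝ := fun n => dampedInv ((n : ℝ) + 2)⁻¹ (n + 2) 
  have key : ∀ n, ∫ t in Ioi (0 : ℝ), k n t * ∫ ω, Real.sin (t * Y ω) ∂μ =
      ∫ ω, (Real.arctan (Y ω * (n + 2)) - Real.arctan (Y ω * ((n : ℝ) + 2)⁻¹)) ∂μ := by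
    intro n
    rw [integral_mul_integral_comp (integrableOn_dampedInv (inv_pos.2 (hM n)) (hle n)) hY
      Real.measurable_sin Real.abs_sin_le_one]
    refine integral_congr_ae (ae_of_all _ fun ω => ?_)
    simp only
    rw [integral_dampedInv_mul_sin (inv_pos.2 (hM n)) (hle n), div_inv_eq_mul, div_eq_mul_inv]
  have lim1 : Tendsto (fun n => ∫ t in Ioi (0 : ℝ), k n t * ∫ ω, Real.sin (t * Y ω) ∂μ) atTop
      (𝓝 (∫ t in Ioi (0 : ℝ), (∫ ω, Real.sin (t * Y ω) ∂μ) / t)) := by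
    have hsm : StronglyMeasurable fun t : ℝ => ∫ ω, Real.sin (t * Y ω) ∂μ := by
      refine StronglyMeasurable.integral_prod_right (f := fun (t : ℝ) ω => Real.sin (t * Y ω)) ?_
      exact Measurable.stronglyMeasurable (by fun_prop)
    refine tendsto_integral_of_dominated_convergence
      (fun t => ‖(∫ ω, Real.sin (t * Y ω) ∂μ) / t‖) (fun n => ?_) hint.norm (fun n => ?_) ?_
    · exact ((measurable_dampedInv _ _).stronglyMeasurable.mul hsm).aestronglyMeasurable
    · filter_upwards [ae_restrict_mem measurableSet_Ioi] with t ht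
      rw [norm_mul, norm_div, Real.norm_of_nonneg (dampedInv_nonneg (hle n) ht),
        Real.norm_of_nonneg (le_of_lt ht), mul_comm, div_eq_mul_one_div]
      gcongr
      exact dampedInv_le_inv (inv_pos.2 (hM n)).le ht
    · filter_upwards [ae_restrict_mem measurableSet_Ioi] with t ht
      rw [div_eq_mul_one_div, mul_comm]
      refine Tendsto.mul_const _ (Tendsto.div_const ?_ t)
      have e1 : Tendsto (fun n : ℕ => Real.exp (-(((n : ℝ) + 2)⁻¹ * t))) atTop (𝓝 1) := by
        have := (Real.continuous_exp.tendsto _).comp (hM0.mul_const t).neg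
        simpa [Function.comp_def] using this
      have e2 : Tendsto (fun n : ℕ => Real.exp (-(((n : ℝ) + 2) * t))) atTop (𝓝 0) :=
        Real.tendsto_exp_atBot.comp
          (tendsto_neg_atTop_atBot.comp (hMtop.atTop_mul_const ht))
      simpa using e1.sub e2
  -- The limit is `π / 2` times the sign of `Y`, written with the indicator of `Y < 0`; the two
  -- agree almost everywhere because `Y ≠ 0`.
  have lim2 : Tendsto (fun n : ℕ => ∫ ω, (Real.arctan (Y ω * (n + 2)) -
      Real.arctan (Y ω * ((n : ℝ) + 2)⁻¹)) ∂μ) atTop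
      (𝓝 (∫ ω, (Real.pi / 2 - Real.pi * ({ω | Y ω < 0}.indicator (fun _ => (1 : ℝ)) ω)) ∂μ)) := by
    refine tendsto_integral_of_dominated_convergence (fun _ => Real.pi) (fun n => ?_)
      (integrable_const _) (fun n => ae_of_all _ fun ω => ?_) ?_
    · exact Measurable.aestronglyMeasurable (by fun_prop)
    · have a1 := Real.arctan_lt_pi_div_two (Y ω * (n + 2))
      have a2 := Real.neg_pi_div_two_lt_arctan (Y ω * (n + 2))
      have a3 := Real.arctan_lt_pi_div_two (Y ω * ((n : ℝ) + 2)⁻¹)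
      have a4 := Real.neg_pi_div_two_lt_arctan (Y ω * ((n : ℝ) + 2)⁻¹)
      rw [Real.norm_eq_abs, abs_le]
      constructor <;> linarith
    · have h0' : ∀ᵐ ω ∂μ, Y ω ≠ 0 := by rw [ae_iff]; simpa using h0
      filter_upwards [h0'] with ω hω
      have e2 : Tendsto (fun n : ℕ => Real.arctan (Y ω * ((n : ℝ) + 2)⁻¹)) atTop (𝓝 0) := by
        have := (Real.continuous_arctan.tendsto _).comp (hM0.const_mul (Y ω))
        simpa [Function.comp_def] using this
      rcases lt_or_gt_of_ne hω with h | h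
      · have e1 : Tendsto (fun n : ℕ => Real.arctan (Y ω * ((n : ℝ) + 2))) atTop
            (𝓝 (-(Real.pi / 2))) :=
          (Real.tendsto_arctan_atBot.mono_right nhdsWithin_le_nhds).comp
            (hMtop.const_mul_atTop_of_neg h)
        convert e1.sub e2 using 2
        simp [h]; ring
      · have e1 : Tendsto (fun n : ℕ => Real.arctan (Y ω * ((n : ℝ) + 2))) atTop
            (𝓝 (Real.pi / 2)) :=
          (Real.tendsto_arctan_atTop.mono_right nhdsWithin_le_nhds).comp
            (hMtop.const_mul_atTop h)
        convert e1.sub e2 using 2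
        simp [h.le]
  have hms : MeasurableSet {ω | Y ω < 0} := measurableSet_lt hY measurable_const
  rw [tendsto_nhds_unique lim1 ((funext key) ▸ lim2), integral_sub (integrable_const _)
    (((integrable_const _).indicator hms).const_mul _), integral_const_mul,
    integral_indicator_const _ hms]
  simp
  ring

/-- The law of `Y` has no atom at `0` if its characteristic function decays. -/
lemma measure_eq_zero_of_integrableOn_cos {Y : Ω → ℝ} (hY : Measurable Y)
    (hint : IntegrableOn (fun t => (∫ ω, Real.cos (t * Y ω) ∂μ) / t) (Ioi 1)) :
    μ {ω | Y ω = 0} = 0 := by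
  have hE0 : Tendsto (fun n : ℕ => ((n : ℝ) + 1)⁻¹) atTop (𝓝 0) :=
    (tendsto_atTop_add_const_right _ _ tendsto_natCast_atTop_atTop).inv_tendsto_atTop
  have hEpos : ∀ n : ℕ, 0 < ((n : ℝ) + 1)⁻¹ := fun n => by positivity
  have hEle : ∀ n : ℕ, ((n : ℝ) + 1)⁻¹ ≤ 1 := fun n =>
    inv_le_one_of_one_le₀ (by linarith [(n.cast_nonneg : (0 : ℝ) ≤ n)])
  set C : ℝ → ℝ := fun t => ∫ ω, Real.cos (t * Y ω) ∂μ with hC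
  have hC1 : ∀ t, ‖C t‖ ≤ 1 := fun t => by
    refine (norm_integral_le_of_norm_le_const (C := 1) (ae_of_all _ fun ω => ?_)).trans (by simp)
    exact Real.abs_cos_le_one _
  have hsm : StronglyMeasurable C := by
    refine StronglyMeasurable.integral_prod_right (f := fun (t : ℝ) ω => Real.cos (t * Y ω)) ?_
    exact Measurable.stronglyMeasurable (by fun_prop)
  have hms : MeasurableSet {ω | Y ω = 0} := hY (measurableSet_singleton 0)
  -- The kernel `e * exp (-(e * t))` turns `cos (t * y)` into `e² / (e² + y²)`, which is `1` at `y =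
  -- 0` and nonnegative elsewhere.
  have lower : ∀ n : ℕ, μ.real {ω | Y ω = 0} ≤
      ∫ t in Ioi (0 : ℝ), ((n : ℝ) + 1)⁻¹ * Real.exp (-(((n : ℝ) + 1)⁻¹ * t)) * C t := by
    intro n
    set e := ((n : ℝ) + 1)⁻¹
    have he : 0 < e := hEpos n
    rw [hC, integral_mul_integral_comp ((integrableOn_exp_neg_mul he).const_mul e) hY
      Real.measurable_cos Real.abs_cos_le_one]
    simp_rw [mul_assoc, integral_const_mul, integral_exp_neg_mul_cos he]
    rw [← integral_const_mul]
    have : μ.real {ω | Y ω = 0} = ∫ ω, {ω | Y ω = 0}.indicator (fun _ => (1 : ℝ)) ω ∂μ := by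
      rw [integral_indicator_const _ hms]; simp
    rw [this]
    have hb : ∀ y : ℝ, 0 ≤ e * (e / (e ^ 2 + y ^ 2)) := fun y => by positivity
    have hi : Integrable ({ω | Y ω = 0}.indicator fun _ => (1 : ℝ)) μ :=
      (integrable_const _).indicator hms
    refine integral_mono hi ?_ fun ω => ?_
    · refine Integrable.mono' (integrable_const (1 : ℝ))
        (Measurable.aestronglyMeasurable (by fun_prop)) (ae_of_all _ fun ω => ?_)
      rw [Real.norm_of_nonneg (hb _), ← mul_div_assoc, div_le_one (by positivity)]
      nlinarith [sq_nonneg (Y ω)]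
    · by_cases h : Y ω = 0
      · simp [h]; field_simp; rfl
      · simpa [h] using hb (Y ω)
  have lim : Tendsto (fun n : ℕ => ∫ t in Ioi (0 : ℝ),
      ((n : ℝ) + 1)⁻¹ * Real.exp (-(((n : ℝ) + 1)⁻¹ * t)) * C t) atTop
      (𝓝 (∫ t in Ioi (0 : ℝ), 0)) := by
    -- On `(0, 1]` everything is at most `1`; beyond `1`, `u ≤ exp u` at `u = e * t` gives `e * exp
    -- (-(e * t)) ≤ 1 / t`, so `hint` dominates.
    refine tendsto_integral_of_dominated_convergence
      ((Ioc 0 1).indicator (fun _ => (1 : ℝ)) + (Ioi 1).indicator fun t => ‖C t / t‖)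
      (fun n => ?_) ?_ (fun n => ?_) ?_
    · exact (Measurable.stronglyMeasurable (by fun_prop) |>.mul hsm).aestronglyMeasurable
    · refine Integrable.add ?_ ?_
      · exact ((integrable_indicator_iff measurableSet_Ioc).2
          (integrableOn_const (by simp))).integrableOn
      · exact ((integrable_indicator_iff measurableSet_Ioi).2 hint.norm).integrableOn
    · filter_upwards [ae_restrict_mem measurableSet_Ioi] with t ht
      have ht : 0 < t := ht
      rw [norm_mul, Real.norm_of_nonneg (by positivity)]
      have hexp : Real.exp (-(((n : ℝ) + 1)⁻¹ * t)) ≤ 1 :=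
        Real.exp_le_one_iff.2 (by have := mul_pos (hEpos n) ht; linarith)
      rcases le_or_gt t 1 with h1 | h1
      · simp only [Pi.add_apply, indicator, mem_Ioc, ht, h1, mem_Ioi, not_lt.2 h1, true_and,
          if_true, if_false, add_zero]
        exact mul_le_one₀ (mul_le_one₀ (hEle n) (Real.exp_pos _).le hexp) (norm_nonneg _) (hC1 t)
      · simp only [Pi.add_apply, indicator, mem_Ioc, not_le.2 h1, mem_Ioi, h1, and_false,
          if_true, if_false, zero_add]
        rw [norm_div, Real.norm_of_nonneg ht.le, mul_comm, div_eq_mul_one_div]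
        gcongr
        rw [le_div_iff₀ ht]
        have hx := Real.add_one_le_exp (((n : ℝ) + 1)⁻¹ * t)
        rw [Real.exp_neg, mul_right_comm, ← div_eq_mul_inv, div_le_one (Real.exp_pos _)]
        linarith
    · refine ae_of_all _ fun t => ?_
      have e1 : Tendsto (fun n : ℕ => Real.exp (-(((n : ℝ) + 1)⁻¹ * t))) atTop (𝓝 1) := by
        have := (Real.continuous_exp.tendsto _).comp (hE0.mul_const t).neg
        simpa [Function.comp_def] using this
      simpa using (hE0.mul e1).mul_const (C t)
  rw [integral_zero] at lim
  have : μ.real {ω | Y ω = 0} ≤ 0 := ge_of_tendsto' lim lower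
  exact (measureReal_eq_zero_iff (by finiteness)).1 (le_antisymm this measureReal_nonneg)

end Inversion

/-! ### Counts, generating functional and mean formula of the Poisson process. -/

section Poisson

variable {Ω : Type*} {z : ℕ → Ω → ℝ} {B : Set ℝ} {ω : Ω}

lemma rsuProcess_apply (hB : MeasurableSet B) :
    rsuProcess z ω B = ∑' i, B.indicator 1 (z i ω) := by
  simp [rsuProcess, Measure.sum_apply _ hB, Measure.dirac_apply' _ hB]

lemma finite_of_rsuProcess_ne_top (hB : MeasurableSet B) (h : rsuProcess z ω B ≠ ∞) :
    {i | z i ω ∈ B}.Finite := by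
  rw [rsuProcess_apply hB] at h
  refine (ENNReal.finite_const_le_of_tsum_ne_top h one_ne_zero).subset fun i hi => ?_
  simp [indicator_of_mem (show z i ω ∈ B from hi)]

lemma rsuProcess_eq_card (hB : MeasurableSet B) {S : Finset ℕ} (hS : ∀ i, i ∈ S ↔ z i ω ∈ B) :
    rsuProcess z ω B = S.card := by
  rw [rsuProcess_apply hB, tsum_eq_sum (s := S) fun i hi => by simp [← hS, hi]]
  simp only [Finset.card_eq_sum_ones, Nat.cast_sum, Nat.cast_one]
  exact Finset.sum_congr rfl fun i hi => by simp [(hS i).1 hi]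

variable [MeasurableSpace Ω] {μ : Measure Ω} {lam : ℝ}

lemma integral_pow_poissonMeasure (r : ℝ≥0) (v : ℂ) :
    ∫ k, v ^ k ∂(poissonMeasure r) = Complex.exp (r * (v - 1)) := by
  rw [integral_poissonMeasure]
  calc ∑' k : ℕ, (Real.exp (-r) * r ^ k / k.factorial) • v ^ k
      = ∑' k : ℕ, (Real.exp (-r) : ℂ) * ((r * v) ^ k / k.factorial) := by
        congr with k
        rw [Complex.real_smul]
        push_cast
        ring
    _ = Complex.exp (r * (v - 1)) := by
        rw [tsum_mul_left, (NormedSpace.expSeries_div_hasSum_exp (r * v : ℂ)).tsum_eq,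
          ← Complex.exp_eq_exp_ℂ, Complex.ofReal_exp, ← Complex.exp_add]
        push_cast
        ring_nf

/-- The generating function of a count, extended to `ℝ≥0∞`. -/
def countPow (v : ℂ) (k : ℝ≥0∞) : ℂ := v ^ ⌊k.toReal⌋₊

lemma measurable_countPow (v : ℂ) : Measurable (countPow v) :=
  (measurable_of_countable fun k : ℕ => v ^ k).comp
    (Nat.measurable_floor.comp ENNReal.measurable_toReal)

@[simp] lemma countPow_natCast (v : ℂ) (k : ℕ) : countPow v k = v ^ k := by simp [countPow]

section

variable (hP : IsPoissonPointProcess μ (rsuProcess z) (ENNReal.ofReal lam • (volume : Measure ℝ)))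
include hP

lemma IsPoissonPointProcess.measurable_count (hB : MeasurableSet B) :
    Measurable fun ω => rsuProcess z ω B :=
  (Measure.measurable_coe hB).comp hP.measurable

lemma IsPoissonPointProcess.integral_comp_count (hB : MeasurableSet B) (hvol : volume B < ∞)
    {f : ℝ≥0∞ → ℂ} (hf : Measurable f) :
    ∫ ω, f (rsuProcess z ω B) ∂μ =
      ∫ k, f k ∂(poissonMeasure (ENNReal.ofReal lam * volume B).toNNReal) := by
  have h := hP.law_count B hB (by simpa using ENNReal.mul_lt_top (by simp) hvol)
  rw [← integral_map (hP.measurable_count hB).aemeasurable hf.aestronglyMeasurable, h,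
    integral_map (by fun_prop) hf.aestronglyMeasurable]
  simp

lemma IsPoissonPointProcess.lintegral_count (hB : MeasurableSet B) (hvol : volume B < ∞) :
    ∫⁻ ω, rsuProcess z ω B ∂μ = ENNReal.ofReal lam * volume B := by
  have h := hP.law_count B hB (by simpa using ENNReal.mul_lt_top (by simp) hvol)
  have hfin : ENNReal.ofReal lam * volume B ≠ ∞ := (ENNReal.mul_lt_top (by simp) hvol).ne
  set r := (ENNReal.ofReal lam * volume B).toNNReal with hr
  have h1 : ∫⁻ ω, rsuProcess z ω B ∂μ = ∫⁻ x, x ∂(μ.map fun ω => rsuProcess z ω B) := by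
    rw [lintegral_map measurable_id' (hP.measurable_count hB)]
  rw [h1, h, lintegral_map measurable_id' (by fun_prop)]
  simp only [Measure.smul_apply, smul_eq_mul, ← hr]
  rw [poissonMeasure, lintegral_sum_measure]
  simp only [lintegral_smul_measure, lintegral_dirac, smul_eq_mul]
  -- The identity `(k + 1) P(N = k + 1) = r P(N = k)` reduces the mean to the total mass.
  have hstep : ∀ k : ℕ, ENNReal.ofReal (Real.exp (-r) * r ^ (k + 1) / (k + 1).factorial) *
      ((k + 1 : ℕ) : ℝ≥0∞) = r * ENNReal.ofReal (Real.exp (-r) * r ^ k / k.factorial) := by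
    intro k
    rw [← ENNReal.ofReal_natCast, ← ENNReal.ofReal_mul (by positivity),
      ← ENNReal.ofReal_coe_nnreal, ← ENNReal.ofReal_mul (by positivity)]
    congr 1
    rw [Nat.factorial_succ]
    push_cast
    field_simp
    rw [pow_succ']
  rw [tsum_eq_zero_add' ENNReal.summable]
  simp_rw [hstep]
  rw [ENNReal.tsum_mul_left, ← ENNReal.ofReal_tsum_of_nonneg (fun k => by positivity)
    (hasSum_one_poissonMeasure r).summable, (hasSum_one_poissonMeasure r).tsum_eq]
  rw [ENNReal.ofReal_one, mul_one, hr, ENNReal.coe_toNNReal hfin, Nat.cast_zero,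
    mul_zero, zero_add]

lemma IsPoissonPointProcess.ae_finite (hB : MeasurableSet B) (hvol : volume B < ∞) :
    ∀ᵐ ω ∂μ, {i | z i ω ∈ B}.Finite := by
  have h : ∫⁻ ω, rsuProcess z ω B ∂μ ≠ ∞ := by
    rw [hP.lintegral_count hB hvol]; exact (ENNReal.mul_lt_top (by simp) hvol).ne
  filter_upwards [ae_lt_top (hP.measurable_count hB) h] with ω hω
  exact finite_of_rsuProcess_ne_top hB hω.ne

/-- Joint generating function of the counts in disjoint sets. -/
lemma IsPoissonPointProcess.integral_prod_countPow (hlam : 0 ≤ lam) {n : ℕ} {B : Fin n → Set ℝ}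
    (hB : ∀ j, MeasurableSet (B j)) (hd : Pairwise fun i j => Disjoint (B i) (B j))
    (hvol : ∀ j, volume (B j) < ∞) (v : Fin n → ℂ) :
    ∫ ω, ∏ j, countPow (v j) (rsuProcess z ω (B j)) ∂μ =
      ∏ j, Complex.exp (lam * volume.real (B j) * (v j - 1)) := by
  rw [(hP.indep_count n B hB hd).integral_fun_prod_comp (f := fun j => countPow (v j))
    (fun j => (hP.measurable_count (hB j)).aemeasurable)
    (fun j => (measurable_countPow _).aestronglyMeasurable)]
  refine Finset.prod_congr rfl fun j _ => ?_
  rw [hP.integral_comp_count (hB j) (hvol j) (measurable_countPow _)]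
  simp only [countPow_natCast, integral_pow_poissonMeasure]
  congr 3
  rw [Measure.real, ENNReal.coe_toNNReal_eq_toReal, ENNReal.toReal_mul,
    ENNReal.toReal_ofReal hlam, Complex.ofReal_mul]

/-- Probability generating functional at a simple function. -/
lemma IsPoissonPointProcess.integral_finprod (hlam : 0 ≤ lam) (w : SimpleFunc ℝ ℂ)
    (hw : volume {y | w y ≠ 1} < ∞) :
    ∫ ω, ∏ᶠ i, w (z i ω) ∂μ = Complex.exp (lam * ∫ y, (w y - 1)) := by
  classical
  -- Points where `w = 1` do not affect the product. The other values are finitely many and their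
  -- level sets have finite volume, so the product is `∏ v ^ N(w = v)` with independent Poisson
  -- counts.
  set V := w.range.erase 1 with hV
  set e := V.equivFin.symm with he
  have hne : ∀ v ∈ V, v ≠ 1 := fun v hv => (Finset.mem_erase.1 hv).1
  have hmem : ∀ y, w y ≠ 1 → w y ∈ V := fun y hy =>
    Finset.mem_erase.2 ⟨hy, w.mem_range_self y⟩
  have hBm : ∀ v, MeasurableSet (w ⁻¹' {v}) := fun v => w.measurableSet_fiber v
  have hBv : ∀ v ∈ V, volume (w ⁻¹' {v}) < ∞ := fun v hv =>
    (measure_mono fun y (hy : w y = v) => by simpa [hy] using hne v hv).trans_lt hw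
  have hprod := hP.integral_prod_countPow hlam (B := fun j => w ⁻¹' {(e j : ℂ)})
    (fun j => hBm _) (fun i j hij => by
      refine Disjoint.preimage _ (disjoint_singleton.2 fun h => hij ?_)
      exact e.injective (Subtype.ext h)) (fun j => hBv _ (e j).2) (fun j => e j)
  have hms : MeasurableSet {y | w y ≠ 1} := (hBm 1).compl
  have hlhs : ∫ ω, ∏ᶠ i, w (z i ω) ∂μ =
      ∫ ω, ∏ j, countPow (e j) (rsuProcess z ω (w ⁻¹' {(e j : ℂ)})) ∂μ := by
    refine integral_congr_ae ?_
    filter_upwards [hP.ae_finite hms hw] with ω hω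
    set S := hω.toFinset with hS
    have hSm : ∀ i, i ∈ S ↔ w (z i ω) ≠ 1 := fun i => by simp [hS]
    rw [finprod_eq_prod_of_mulSupport_subset (s := S) _ fun i hi => by
        simpa [hSm] using hi]
    rw [e.prod_comp fun v : V => countPow v (rsuProcess z ω (w ⁻¹' {(v : ℂ)})),
      Finset.prod_coe_sort V fun v => countPow v (rsuProcess z ω (w ⁻¹' {v})),
      ← Finset.prod_fiberwise_of_maps_to' (fun i hi => hmem _ ((hSm i).1 hi)) fun v => v]
    refine Finset.prod_congr rfl fun v hv => ?_
    rw [rsuProcess_eq_card (S := S.filter fun i => w (z i ω) = v) (hBm v) fun i => ?_,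
      countPow_natCast, Finset.prod_const]
    simp only [Finset.mem_filter, hSm, mem_preimage, mem_singleton_iff, and_iff_right_iff_imp]
    exact fun h => h ▸ hne v hv
  have hrhs : ∫ y, (w y - 1) = ∑ v ∈ V, volume.real (w ⁻¹' {v}) * (v - 1) := by
    have : ∀ y, w y - 1 = ∑ v ∈ V, (w ⁻¹' {v}).indicator (fun _ => v - 1) y := by
      intro y
      by_cases hy : w y = 1
      · rw [Finset.sum_eq_zero fun v hv => ?_, hy, sub_self]
        rw [indicator_of_notMem]
        simpa [hy] using (hne v hv).symm
      · rw [Finset.sum_eq_single_of_mem _ (hmem y hy) fun v _ hv => ?_]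
        · simp
        · rw [indicator_of_notMem]
          simpa using hv.symm
    simp_rw [this]
    rw [integral_finsetSum]
    · refine Finset.sum_congr rfl fun v hv => ?_
      rw [integral_indicator_const _ (hBm v), Complex.real_smul]
    · exact fun v hv => (integrable_indicator_iff (hBm v)).2 (integrableOn_const (hBv v hv).ne)
  rw [hlhs, hprod, hrhs,
    e.prod_comp fun v : V => Complex.exp (lam * volume.real (w ⁻¹' {(v : ℂ)}) * (v - 1)),
    Finset.prod_coe_sort V fun v => Complex.exp (lam * volume.real (w ⁻¹' {v}) * (v - 1)),
    ← Complex.exp_sum, Finset.mul_sum]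
  simp_rw [mul_assoc]

/-- Campbell's formula for the mean. -/
lemma IsPoissonPointProcess.lintegral_lintegral {f : ℝ → ℝ≥0∞} (hf : Measurable f) :
    ∫⁻ ω, ∫⁻ y, f y ∂(rsuProcess z ω) ∂μ = ENNReal.ofReal lam * ∫⁻ y, f y := by
  -- The mean measure is compared with `λ` times Lebesgue measure on spanning sets, as count laws
  -- are given only for finite intensity.
  have : μ.bind (rsuProcess z) = ENNReal.ofReal lam • (volume : Measure ℝ) := by
    refine Measure.ext_of_iUnion_eq_univ (iUnion_spanningSets (volume : Measure ℝ)) fun n => ?_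
    have hs := measurableSet_spanningSets (volume : Measure ℝ) n
    ext B hB
    rw [Measure.restrict_apply hB, Measure.restrict_apply hB,
      Measure.bind_apply (hB.inter hs) hP.measurable.aemeasurable,
      hP.lintegral_count (hB.inter hs), Measure.smul_apply, smul_eq_mul]
    exact (measure_mono inter_subset_right).trans_lt (measure_spanningSets_lt_top _ n)
  rw [← Measure.lintegral_bind hP.measurable.aemeasurable hf.aemeasurable, this,
    lintegral_smul_measure, smul_eq_mul]

end

end Poisson

/-! ### Independent activity marks and the shot noise of active points. -/

section Thinning

/-- Independence lets `X` be frozen while `Y` is averaged. It is applied to locations against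
activities, interference against serving gain, and configuration against fading. -/
lemma IndepFun.integral_comp_eq_integral_integral {Ω α β E : Type*} [MeasurableSpace Ω]
    [MeasurableSpace α] [MeasurableSpace β] [NormedAddCommGroup E] [NormedSpace ℝ E]
    {μ : Measure Ω} [IsProbabilityMeasure μ] {X : Ω → α} {Y : Ω → β} (h : IndepFun X Y μ)
    (hX : Measurable X) (hY : Measurable Y) {F : α × β → E} (hF : StronglyMeasurable F) {C : ℝ}
    (hC : ∀ q, ‖F q‖ ≤ C) :
    ∫ ω, F (X ω, Y ω) ∂μ = ∫ ω, ∫ ω', F (X ω, Y ω') ∂μ ∂μ := by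
  have : IsProbabilityMeasure (μ.map X) := Measure.isProbabilityMeasure_map hX.aemeasurable
  have : IsProbabilityMeasure (μ.map Y) := Measure.isProbabilityMeasure_map hY.aemeasurable
  rw [← integral_map (φ := fun ω => (X ω, Y ω)) (hX.prodMk hY).aemeasurable
      hF.aestronglyMeasurable,
    (indepFun_iff_map_prod_eq_prod_map_map hX.aemeasurable hY.aemeasurable).1 h,
    integral_prod _ (Integrable.of_bound hF.aestronglyMeasurable C (ae_of_all _ hC)),
    integral_map hX.aemeasurable hF.integral_prod_right'.aestronglyMeasurable]
  refine integral_congr_ae (ae_of_all _ fun ω => ?_)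
  exact integral_map hY.aemeasurable (hF.comp_measurable measurable_prodMk_left).aestronglyMeasurable

variable {Ω : Type*} {z : ℕ → Ω → ℝ} {act : ℕ → Ω → Bool}

lemma lintegral_activeProcess (f : ℝ → ℝ≥0∞) (ω : Ω) :
    ∫⁻ y, f y ∂(activeProcess z act ω) = ∑' i, if act i ω = true then f (z i ω) else 0 := by
  rw [activeProcess, lintegral_sum_measure]
  refine tsum_congr fun i => ?_
  split_ifs <;> simp

lemma activeProcess_le (ω : Ω) : activeProcess z act ω ≤ rsuProcess z ω := by
  refine Measure.le_iff.2 fun s hs => ?_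
  rw [activeProcess, rsuProcess, Measure.sum_apply _ hs, Measure.sum_apply _ hs]
  refine ENNReal.tsum_le_tsum fun i => ?_
  split_ifs <;> simp

/-- The event `r ≤ R` says that the open ball of radius `r` is void; whether the infimum is attained
never matters. -/
lemma le_servingDist_iff {r : ℝ} {ω : Ω} : r ≤ servingDist z ω ↔ ∀ i, r ≤ |z i ω| :=
  le_ciInf_iff ⟨0, by rintro _ ⟨i, rfl⟩; exact abs_nonneg _⟩

variable [MeasurableSpace Ω] {μ : Measure Ω} [IsProbabilityMeasure μ] {lam p : ℝ}

lemma measurable_servingDist (hz : ∀ i, Measurable (z i)) : Measurable (servingDist z) :=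
  Measurable.iInf fun i => (hz i).abs

lemma measurable_activeProcess (hz : ∀ i, Measurable (z i)) (ha : ∀ i, Measurable (act i)) :
    Measurable (activeProcess z act) := by
  refine Measure.measurable_of_measurable_coe _ fun s hs => ?_
  simp only [activeProcess, Measure.sum_apply _ hs]
  refine Measurable.tsum fun i => ?_
  have : (fun ω => (if act i ω = true then Measure.dirac (z i ω) else 0 : Measure ℝ) s) =
      fun ω => if act i ω = true then s.indicator 1 (z i ω) else 0 := by
    ext ω; split_ifs <;> simp [Measure.dirac_apply' _ hs]
  rw [this]
  exact Measurable.ite (ha i (measurableSet_singleton true))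
    ((measurable_one.indicator hs).comp (hz i)) measurable_const

lemma measurable_lintegral_activeProcess (hz : ∀ i, Measurable (z i))
    (ha : ∀ i, Measurable (act i)) {g : ℝ → ℝ≥0∞} (hg : Measurable g) :
    Measurable fun ω => ∫⁻ y, g y ∂(activeProcess z act ω) :=
  (Measure.measurable_lintegral hg).comp (measurable_activeProcess hz ha)

/-- Generating function of independent activity marks. -/
lemma integral_prod_activity (ham : ∀ i, Measurable (act i))
    (ha : ∀ i, μ {ω | act i ω = true} = ENNReal.ofReal p) (hp : 0 ≤ p)
    (hi : iIndepFun act μ) (S : Finset ℕ) (c : ℕ → ℂ) :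
    ∫ ω, ∏ i ∈ S, (if act i ω = true then c i else 1) ∂μ = ∏ i ∈ S, (1 + p * (c i - 1)) := by
  have h := (hi.precomp (g := fun i : S => (i : ℕ)) Subtype.val_injective).integral_fun_prod_comp
    (f := fun (i : S) (b : Bool) => if b = true then c i else 1)
    (fun i => (ham i).aemeasurable)
    (fun i => (measurable_of_countable _).aestronglyMeasurable)
  have e : ∀ ω, ∏ i ∈ S, (if act i ω = true then c i else 1) =
      ∏ i : S, (if act i ω = true then c i else 1) := fun ω =>
    (Finset.prod_coe_sort S fun i => if act i ω = true then c i else 1).symm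
  simp_rw [e]
  rw [h, Finset.prod_coe_sort S fun i => ∫ ω, (if act i ω = true then c i else 1) ∂μ]
  refine Finset.prod_congr rfl fun i _ => ?_
  have hms : MeasurableSet {ω | act i ω = true} := ham i (measurableSet_singleton true)
  have e2 : ∀ ω, (if act i ω = true then c i else 1) =
      1 + {ω | act i ω = true}.indicator (fun _ => c i - 1) ω := fun ω => by
    by_cases h : act i ω = true <;> simp [h]
  simp_rw [e2]
  rw [integral_add (integrable_const _) ((integrable_const _).indicator hms),
    integral_indicator_const _ hms, Measure.real, ha, ENNReal.toReal_ofReal hp]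
  simp

lemma norm_exp_ofReal_mul_I_mul (t : ℝ) (x : ℝ) : ‖Complex.exp (t * x * Complex.I)‖ = 1 := by
  rw [← Complex.ofReal_mul]; exact Complex.norm_exp_ofReal_mul_I _

lemma norm_exp_sub_one_le (t : ℝ) (x : ℝ) : ‖Complex.exp (t * x * Complex.I) - 1‖ ≤ |t| * |x| := by
  have := Real.norm_exp_I_mul_ofReal_sub_one_le (x := t * x)
  rw [Real.norm_eq_abs, abs_mul] at this
  convert this using 4
  push_cast; ring

section

variable (hP : IsPoissonPointProcess μ (rsuProcess z) (ENNReal.ofReal lam • (volume : Measure ℝ)))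
  (hlam : 0 ≤ lam) (hp : 0 ≤ p) (hz : ∀ i, Measurable (z i)) (ham : ∀ i, Measurable (act i))
  (ha : ∀ i, μ {ω | act i ω = true} = ENNReal.ofReal p) (hi : iIndepFun act μ)
  (hza : IndepFun (fun ω i => z i ω) (fun ω i => act i ω) μ)
include hP hlam hp hz ham ha hi hza

/-- Averaging the marks turns each factor `exp(itg)` into `1 + p (exp(itg) - 1)`. Giving the weight
`w` the value `0` on the ball of radius `s` makes the product vanish unless `s ≤ R`, so one
generating functional encodes both the void event and the shot noise. The ball contributes `-2s` to
`∫ (w - 1)`. -/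
lemma integral_indicator_exp_active_simple {s : ℝ} (hs : 0 ≤ s) (t : ℝ) (g : SimpleFunc ℝ ℝ≥0∞)
    (hgt : ∀ y, g y ≠ ∞) (hgs : volume (Function.support g) < ∞) (hg0 : ∀ y, |y| < s → g y = 0) :
    ∫ ω, {ω | s ≤ servingDist z ω}.indicator (fun ω => Complex.exp
        (t * (∫⁻ y, g y ∂(activeProcess z act ω)).toReal * Complex.I)) ω ∂μ =
      Real.exp (-(2 * lam * s)) *
        Complex.exp (lam * p * ∫ y, (Complex.exp (t * (g y).toReal * Complex.I) - 1)) := by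
  classical
  have hms : MeasurableSet {y : ℝ | |y| < s} := measurableSet_lt (by fun_prop) measurable_const
  set u : ℝ≥0∞ → ℂ := fun x => 1 + p * (Complex.exp (t * x.toReal * Complex.I) - 1) with hu
  set w : SimpleFunc ℝ ℂ := SimpleFunc.piecewise {y | |y| < s} hms (SimpleFunc.const ℝ 0)
    (g.map u) with hw
  have hwlt : ∀ y, |y| < s → w y = 0 := fun y hy => by
    simp [hw, SimpleFunc.piecewise_apply, hy]
  have hwge : ∀ y, s ≤ |y| → w y = u (g y) := fun y hy => by
    simp [hw, SimpleFunc.piecewise_apply, hy]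
  have hball : {y : ℝ | |y| < s} = Ioo (-s) s := by ext y; simp [abs_lt]
  have hvb : volume {y : ℝ | |y| < s} < ∞ := by rw [hball]; simp
  have hwfin : volume {y | w y ≠ 1} < ∞ := by
    refine (measure_mono (t := {y : ℝ | |y| < s} ∪ Function.support g) fun y hy => ?_).trans_lt
      (measure_union_lt_top hvb hgs)
    by_contra h
    simp only [mem_union, mem_ofPred_eq, not_or, not_lt, Function.mem_support, not_not] at h
    exact hy (by rw [hwge y h.1, h.2]; simp [hu])
  set F : (ℕ → ℝ) × (ℕ → Bool) → ℂ := fun q => {q : (ℕ → ℝ) × (ℕ → Bool) |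
    ∀ i, s ≤ |q.1 i|}.indicator (fun q => Complex.exp
      (t * (∑' i, if q.2 i = true then g (q.1 i) else 0).toReal * Complex.I)) q with hF
  have hFm : Measurable F := by
    refine Measurable.indicator ?_ ?_
    · have : Measurable fun q : (ℕ → ℝ) × (ℕ → Bool) =>
          ∑' i, if q.2 i = true then g (q.1 i) else 0 := by
        refine Measurable.tsum fun i => Measurable.ite ?_ (g.measurable.comp (by fun_prop))
          measurable_const
        exact (by fun_prop : Measurable fun q : (ℕ → ℝ) × (ℕ → Bool) => q.2 i)
          (measurableSet_singleton true)
      fun_prop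
    · rw [ofPred_forall]
      exact MeasurableSet.iInter fun i => measurableSet_le measurable_const (by fun_prop)
  have hF1 : ∀ q, ‖F q‖ ≤ 1 := fun q => by
    refine (norm_indicator_le_norm_self _ _).trans ?_
    rw [norm_exp_ofReal_mul_I_mul]
  have h1 : ∫ ω, {ω | s ≤ servingDist z ω}.indicator (fun ω => Complex.exp
        (t * (∫⁻ y, g y ∂(activeProcess z act ω)).toReal * Complex.I)) ω ∂μ =
      ∫ ω, F (fun i => z i ω, fun i => act i ω) ∂μ := by
    refine integral_congr_ae (ae_of_all _ fun ω => ?_)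
    simp only [hF, indicator, mem_ofPred_eq, le_servingDist_iff, lintegral_activeProcess]
  rw [h1, IndepFun.integral_comp_eq_integral_integral hza (by fun_prop) (by fun_prop)
    hFm.stronglyMeasurable hF1]
  have h2 : ∫ ω, ∫ ω', F (fun i => z i ω, fun i => act i ω') ∂μ ∂μ = ∫ ω, ∏ᶠ i, w (z i ω) ∂μ := by
    refine integral_congr_ae ?_
    filter_upwards [hP.ae_finite (w.measurableSet_preimage {x | x ≠ 1}) hwfin,
      hP.ae_finite (g.measurableSet_support) hgs] with ω hω hωg
    by_cases hev : ∀ i, s ≤ |z i ω|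
    · set S := hωg.toFinset with hS
      have hSm : ∀ i, i ∉ S ↔ g (z i ω) = 0 := fun i => by simp [hS]
      have e1 : ∀ ω', F (fun i => z i ω, fun i => act i ω') =
          ∏ i ∈ S, if act i ω' = true then Complex.exp (t * (g (z i ω)).toReal * Complex.I)
            else 1 := by
        intro ω'
        simp only [hF, indicator, mem_ofPred_eq, hev, implies_true, if_true]
        rw [tsum_eq_sum (s := S) fun i hi => by simp [(hSm i).1 hi],
          ENNReal.toReal_sum fun i _ => by split_ifs <;> simp [hgt]]
        push_cast
        rw [Finset.mul_sum, Finset.sum_mul, Complex.exp_sum]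
        refine Finset.prod_congr rfl fun i _ => ?_
        split_ifs <;> simp
      simp_rw [e1]
      rw [integral_prod_activity ham ha hp hi, finprod_eq_prod_of_mulSupport_subset (s := S)]
      · exact Finset.prod_congr rfl fun i _ => (hwge _ (hev i)).symm
      · intro i hi'
        by_contra h
        refine hi' ?_
        simp only
        rw [hwge _ (hev i), (hSm i).1 h]
        simp [hu]
    · have e1 : ∀ ω', F (fun i => z i ω, fun i => act i ω') = 0 := fun ω' =>
        by simp only [hF, indicator, mem_ofPred_eq, hev, if_false]
      simp_rw [e1]
      push Not at hev
      obtain ⟨i, hi'⟩ := hev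
      rw [finprod_eq_prod_of_mulSupport_subset (s := hω.toFinset) _ fun i hi => by simpa using hi,
        Finset.prod_eq_zero (i := i) (by simp [hwlt _ hi']) (hwlt _ hi'), integral_zero]
  rw [h2, hP.integral_finprod hlam w hwfin]
  have hint : Integrable fun y => p * (Complex.exp (t * (g y).toReal * Complex.I) - 1) := by
    refine Integrable.const_mul ?_ _
    have : (fun y => Complex.exp (t * (g y).toReal * Complex.I) - 1) =
        (Function.support g).indicator
          fun y => Complex.exp (t * (g y).toReal * Complex.I) - 1 := by
      ext y
      by_cases h : g y = 0 <;> simp [h]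
    rw [this, integrable_indicator_iff g.measurableSet_support]
    refine IntegrableOn.of_bound hgs ?_ 2 (ae_of_all _ fun y => ?_)
    · have := g.measurable
      exact Measurable.aestronglyMeasurable (by fun_prop)
    · refine (norm_sub_le _ _).trans ?_
      rw [norm_exp_ofReal_mul_I_mul]
      norm_num
  have h3 : ∀ y, w y - 1 = {y : ℝ | |y| < s}.indicator (fun _ => (-1 : ℂ)) y +
      p * (Complex.exp (t * (g y).toReal * Complex.I) - 1) := by
    intro y
    by_cases h : |y| < s
    · simp [hwlt y h, h, hg0 y h]
    · simp [hwge y (not_lt.1 h), h, hu]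
  simp_rw [h3]
  rw [integral_add ((integrable_indicator_iff hms).2 (integrableOn_const hvb.ne)) hint,
    integral_indicator_const _ hms, integral_const_mul, mul_add, Complex.exp_add, hball]
  congr 1
  · rw [Real.volume_real_Ioo_of_le (by linarith), Complex.ofReal_exp]
    congr 1
    rw [Complex.real_smul]
    push_cast; ring
  · rw [mul_assoc]

/-- Characteristic function of a shot noise field of the active points on the event that no point
is closer than `s`. -/
lemma integral_indicator_exp_active {s : ℝ} (hs : 0 ≤ s) (t : ℝ) {g : ℝ → ℝ≥0∞} (hg : Measurable g)
    (hgt : ∀ y, g y ≠ ∞) (hgi : ∫⁻ y, g y ≠ ∞) (hg0 : ∀ y, |y| < s → g y = 0) :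
    ∫ ω, {ω | s ≤ servingDist z ω}.indicator (fun ω => Complex.exp
        (t * (∫⁻ y, g y ∂(activeProcess z act ω)).toReal * Complex.I)) ω ∂μ =
      Real.exp (-(2 * lam * s)) *
        Complex.exp (lam * p * ∫ y, (Complex.exp (t * (g y).toReal * Complex.I) - 1)) := by
  -- The approximants are finite, have supports of finite volume and increase to `g`, so the simple
  -- case applies and the shot noises converge monotonically.
  set φ := SimpleFunc.eapprox g with hφ
  have hle : ∀ n y, φ n y ≤ g y := fun n y => by
    rw [← SimpleFunc.iSup_eapprox_apply hg y]
    exact le_iSup (fun n => φ n y) n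
  have hmono : ∀ y, Monotone fun n => φ n y := fun y m n hmn =>
    SimpleFunc.monotone_eapprox g hmn y
  have hlim : ∀ y, Tendsto (fun n => φ n y) atTop (𝓝 (g y)) := fun y =>
    SimpleFunc.tendsto_eapprox hg y
  have hms : MeasurableSet {ω | s ≤ servingDist z ω} :=
    measurableSet_le measurable_const (measurable_servingDist hz)
  have key := fun n => integral_indicator_exp_active_simple hP hlam hp hz ham ha hi hza hs t (φ n)
    (fun y => (SimpleFunc.eapprox_lt_top g n y).ne) (measure_support_eapprox_lt_top hg hgi n)
    (fun y hy => le_antisymm ((hle n y).trans_eq (hg0 y hy)) zero_le)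
  refine tendsto_nhds_unique (f := fun n => ∫ ω, {ω | s ≤ servingDist z ω}.indicator
    (fun ω => Complex.exp (t * (∫⁻ y, φ n y ∂(activeProcess z act ω)).toReal * Complex.I)) ω ∂μ)
    (l := atTop) ?_ ?_
  · refine tendsto_integral_of_dominated_convergence (fun _ => 1) (fun n => ?_)
      (integrable_const _) (fun n => ae_of_all _ fun ω => ?_) ?_
    · have := measurable_lintegral_activeProcess hz ham (φ n).measurable
      exact (Measurable.indicator (by fun_prop) hms).aestronglyMeasurable
    · refine (norm_indicator_le_norm_self _ _).trans ?_
      rw [norm_exp_ofReal_mul_I_mul]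
    -- By the mean formula the shot noise over all RSUs is almost surely finite. It bounds that of
    -- the active ones, so `toReal` is continuous at the limit.
    · have hfin : ∫⁻ ω, ∫⁻ y, g y ∂(rsuProcess z ω) ∂μ ≠ ∞ := by
        rw [hP.lintegral_lintegral hg]
        exact ENNReal.mul_ne_top (by simp) hgi
      filter_upwards [ae_lt_top ((Measure.measurable_lintegral hg).comp hP.measurable) hfin]
        with ω hω
      have hω' : ∫⁻ y, g y ∂(activeProcess z act ω) ≠ ∞ :=
        ((lintegral_mono' (activeProcess_le ω) le_rfl).trans_lt hω).ne
      have hl : Tendsto (fun n => ∫⁻ y, φ n y ∂(activeProcess z act ω)) atTop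
          (𝓝 (∫⁻ y, g y ∂(activeProcess z act ω))) :=
        lintegral_tendsto_of_tendsto_of_monotone (fun n => (φ n).measurable.aemeasurable)
          (ae_of_all _ hmono) (ae_of_all _ hlim)
      have hl' := (ENNReal.tendsto_toReal hω').comp hl
      by_cases h : s ≤ servingDist z ω
      · simp only [indicator, mem_ofPred_eq, h, if_true]
        have hc : Continuous fun x : ℝ => Complex.exp (t * x * Complex.I) := by fun_prop
        exact (hc.tendsto _).comp hl'
      · simp [h]
  · simp_rw [key]
    refine Tendsto.const_mul _ ((Complex.continuous_exp.tendsto _).comp (Tendsto.const_mul _ ?_))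
    refine tendsto_integral_of_dominated_convergence (fun y => |t| * (g y).toReal) (fun n => ?_)
      ((integrable_toReal_of_lintegral_ne_top hg.aemeasurable hgi).const_mul _)
      (fun n => ae_of_all _ fun y => ?_) (ae_of_all _ fun y => ?_)
    · have := (φ n).measurable
      exact Measurable.aestronglyMeasurable (by fun_prop)
    · refine (norm_exp_sub_one_le _ _).trans ?_
      rw [abs_of_nonneg ENNReal.toReal_nonneg]
      gcongr
      · exact hgt y
      · exact hle n y
    · have hc : Continuous fun x : ℝ => Complex.exp (t * x * Complex.I) - 1 := by fun_prop
      exact (hc.tendsto _).comp ((ENNReal.tendsto_toReal (hgt y)).comp (hlim y))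

end

end Thinning

/-! ### Path-loss functions, their majorants, and approximation of the radius from above. -/

section Attenuation

/-- Contribution of a point at distance `|y|`, in units of the serving distance, to `-log P_c`. -/
def pathLoss (α τ y : ℝ) : ℝ := if 1 < |y| then Real.log (1 + τ * |y| ^ (-α)) else 0

/-- The path-loss function truncated at distance `s`. -/
def tailLoss (α s y : ℝ) : ℝ := if s < |y| then |y| ^ (-α) else 0

variable {α τ : ℝ}

lemma measurable_pathLoss : Measurable (pathLoss α τ) :=
  Measurable.ite (measurableSet_lt measurable_const (by fun_prop)) (by fun_prop) measurable_const

lemma measurable_tailLoss {s : ℝ} : Measurable (tailLoss α s) :=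
  Measurable.ite (measurableSet_lt measurable_const (by fun_prop)) (by fun_prop) measurable_const

lemma tailLoss_nonneg {s y : ℝ} : 0 ≤ tailLoss α s y := by
  unfold tailLoss; split_ifs <;> positivity

lemma pathLoss_nonneg (hτ : 0 ≤ τ) {y : ℝ} : 0 ≤ pathLoss α τ y := by
  unfold pathLoss
  split_ifs
  · exact Real.log_nonneg (by have : 0 ≤ τ * |y| ^ (-α) := by positivity
                              linarith)
  · exact le_rfl

lemma pathLoss_div_eq {r y : ℝ} (hr : 0 < r) : pathLoss α τ (y / r) =
    if r < |y| then Real.log (1 + τ * r ^ α * |y| ^ (-α)) else 0 := by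
  have h : (1 < |y / r|) ↔ r < |y| := by rw [abs_div, abs_of_pos hr, one_lt_div hr]
  simp only [pathLoss, h]
  split_ifs with hy
  · rw [abs_div, abs_of_pos hr, Real.div_rpow (abs_nonneg _) hr.le, Real.rpow_neg hr.le,
      div_inv_eq_mul]
    ring_nf
  · rfl

/-- This is `log (1 + u) ≤ u`. The bound is uniform over radii `r` in `[s, b]`, hence usable for
dominated convergence in the radius. -/
lemma pathLoss_div_le (hτ : 0 ≤ τ) (hα : 0 ≤ α) {s r b y : ℝ} (hs : 0 < s) (hsr : s ≤ r)
    (hrb : r ≤ b) : pathLoss α τ (y / r) ≤ τ * b ^ α * tailLoss α s y := by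
  have hr := hs.trans_le hsr
  have hb := hr.trans_le hrb
  rw [pathLoss_div_eq hr]
  split_ifs with h
  · rw [tailLoss, if_pos (hsr.trans_lt h)]
    have h0 : 0 ≤ τ * r ^ α * |y| ^ (-α) := by positivity
    calc Real.log (1 + τ * r ^ α * |y| ^ (-α)) ≤ τ * r ^ α * |y| ^ (-α) := by
          have := Real.log_le_sub_one_of_pos (x := 1 + τ * r ^ α * |y| ^ (-α)) (by linarith)
          linarith
      _ ≤ τ * b ^ α * |y| ^ (-α) := by gcongr
  · exact mul_nonneg (by positivity) tailLoss_nonneg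

/-- Away from the origin `|y|` is comparable to `1 + |y|`, and `(1 + |y|) ^ (-α)` is integrable on
the line exactly because `α > 1`. -/
lemma integrable_tailLoss (hα : 1 < α) {s : ℝ} (hs : 0 < s) : Integrable (tailLoss α s) := by
  have h := (integrable_one_add_norm (E := ℝ) (μ := volume) (r := α) (by simpa)).const_mul
    ((1 / s + 1) ^ α)
  refine h.mono' measurable_tailLoss.aestronglyMeasurable (ae_of_all _ fun y => ?_)
  rw [Real.norm_of_nonneg tailLoss_nonneg, Real.norm_eq_abs]
  unfold tailLoss
  split_ifs with hy
  · have hy0 : 0 < |y| := hs.trans hy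
    have h1 : 1 + |y| ≤ (1 / s + 1) * |y| := by
      have : 1 ≤ 1 / s * |y| := by rw [one_div_mul_eq_div, le_div_iff₀ hs]; linarith
      linarith
    rw [Real.rpow_neg hy0.le, Real.rpow_neg (by positivity), ← div_eq_mul_inv,
      inv_eq_one_div, div_le_div_iff₀ (by positivity) (by positivity), one_mul,
      ← Real.mul_rpow (by positivity) hy0.le]
    exact Real.rpow_le_rpow (by positivity) h1 (by linarith)
  · positivity

lemma lintegral_tailLoss_ne_top (hα : 1 < α) {s : ℝ} (hs : 0 < s) :
    ∫⁻ y, ENNReal.ofReal (tailLoss α s y) ≠ ∞ :=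
  ((hasFiniteIntegral_iff_ofReal (ae_of_all _ fun _ => tailLoss_nonneg)).1
    (integrable_tailLoss hα hs).2).ne

lemma lintegral_pathLoss_ne_top (hα : 0 ≤ α) (hτ : 0 ≤ τ) {r : ℝ} (hr : 0 < r) {ν : Measure ℝ}
    (h : ∫⁻ y, ENNReal.ofReal (tailLoss α r y) ∂ν ≠ ∞) :
    ∫⁻ y, ENNReal.ofReal (pathLoss α τ (y / r)) ∂ν ≠ ∞ := by
  refine ne_top_of_le_ne_top (ENNReal.mul_ne_top (ENNReal.ofReal_ne_top (r := τ * r ^ α)) h) ?_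
  rw [← lintegral_const_mul' _ _ ENNReal.ofReal_ne_top]
  refine lintegral_mono fun y => ?_
  rw [← ENNReal.ofReal_mul (by positivity)]
  exact ENNReal.ofReal_le_ofReal (pathLoss_div_le hτ hα hr le_rfl le_rfl)

/-- Approach from above matters: `pathLoss` jumps at the cut-off, and a point with `|y| = r`, such
as a serving RSU, must stay excluded along the sequence. -/
lemma tendsto_pathLoss_div {r : ℝ} (hr : 0 < r) {ρ : ℕ → ℝ} (hρ : ∀ n, r < ρ n)
    (hlim : Tendsto ρ atTop (𝓝 r)) (y : ℝ) (hτ : 0 ≤ τ) :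
    Tendsto (fun n => pathLoss α τ (y / ρ n)) atTop (𝓝 (pathLoss α τ (y / r))) := by
  rw [pathLoss_div_eq hr]
  split_ifs with h
  · have e : ∀ᶠ n in atTop, Real.log (1 + τ * ρ n ^ α * |y| ^ (-α)) = pathLoss α τ (y / ρ n) := by
      filter_upwards [hlim.eventually (gt_mem_nhds h)] with n hn
      rw [pathLoss_div_eq (hr.trans (hρ n)), if_pos hn]
    refine Tendsto.congr' e (Tendsto.log ?_ ?_)
    · exact (((hlim.rpow_const (Or.inl hr.ne')).const_mul τ).mul_const _).const_add 1
    · positivity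
  · refine tendsto_const_nhds.congr fun n => ?_
    rw [pathLoss_div_eq (hr.trans (hρ n)), if_neg fun h' => h ((hρ n).trans h')]

lemma tendsto_lintegral_pathLoss (hα : 0 ≤ α) (hτ : 0 ≤ τ) {r : ℝ} (hr : 0 < r) {ν : Measure ℝ}
    (h : ∫⁻ y, ENNReal.ofReal (tailLoss α r y) ∂ν ≠ ∞) {ρ : ℕ → ℝ} (hρ : ∀ n, r < ρ n)
    (hρ' : ∀ n, ρ n ≤ r + 1) (hlim : Tendsto ρ atTop (𝓝 r)) :
    Tendsto (fun n => ∫⁻ y, ENNReal.ofReal (pathLoss α τ (y / ρ n)) ∂ν) atTop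
      (𝓝 (∫⁻ y, ENNReal.ofReal (pathLoss α τ (y / r)) ∂ν)) := by
  refine tendsto_lintegral_of_dominated_convergence
    (fun y => ENNReal.ofReal (τ * (r + 1) ^ α) * ENNReal.ofReal (tailLoss α r y)) (fun n => ?_)
    (fun n => ae_of_all _ fun y => ?_) ?_ (ae_of_all _ fun y => ?_)
  · exact (measurable_pathLoss.comp (by fun_prop)).ennreal_ofReal
  · simp only
    rw [← ENNReal.ofReal_mul (by positivity)]
    exact ENNReal.ofReal_le_ofReal (pathLoss_div_le hτ hα hr (hρ n).le (hρ' n))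
  · rw [lintegral_const_mul' _ _ ENNReal.ofReal_ne_top]
    exact ENNReal.mul_ne_top ENNReal.ofReal_ne_top h
  · exact ENNReal.tendsto_ofReal (tendsto_pathLoss_div hr hρ hlim y hτ)

/-- Approximation of `x` from above on a grid of step `1 / (n + 1)`. -/
def gridAbove (n : ℕ) (x : ℝ) : ℝ := (⌊(n + 1) * x⌋₊ + 1) / (n + 1)

lemma measurable_gridAbove (n : ℕ) : Measurable (gridAbove n) := by
  unfold gridAbove
  exact (((measurable_of_countable fun k : ℕ => (k : ℝ)).comp
    (Nat.measurable_floor.comp (by fun_prop))).add_const 1).div_const _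

lemma lt_gridAbove (n : ℕ) (x : ℝ) : x < gridAbove n x := by
  rw [gridAbove, lt_div_iff₀ (by positivity), mul_comm]
  exact Nat.lt_floor_add_one _

lemma gridAbove_le (n : ℕ) {x : ℝ} (hx : 0 ≤ x) : gridAbove n x ≤ x + 1 / (n + 1) := by
  rw [gridAbove, add_div]
  gcongr
  rw [div_le_iff₀ (by positivity), mul_comm]
  exact Nat.floor_le (by positivity)

lemma gridAbove_le_add_one (n : ℕ) {x : ℝ} (hx : 0 ≤ x) : gridAbove n x ≤ x + 1 := by
  refine (gridAbove_le n hx).trans (by gcongr; rw [div_le_one (by positivity)]; simp)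

lemma tendsto_gridAbove {x : ℝ} (hx : 0 ≤ x) :
    Tendsto (fun n => gridAbove n x) atTop (𝓝 x) := by
  refine tendsto_of_tendsto_of_tendsto_of_le_of_le tendsto_const_nhds ?_
    (fun n => (lt_gridAbove n x).le) (fun n => gridAbove_le n hx)
  simpa using (tendsto_one_div_add_atTop_nhds_zero_nat (𝕜 := ℝ)).const_add x

end Attenuation

/-! ### Integrals and tails of the exponential law. -/

section ExponentialLaw

lemma integral_expMeasure {E : Type*} [NormedAddCommGroup E] [NormedSpace ℝ E] {a : ℝ}
    (ha : 0 < a) (F : ℝ → E) :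
    ∫ x, F x ∂(expMeasure a) = ∫ x in Ioi 0, (a * Real.exp (-(a * x))) • F x := by
  have hm : Measurable (exponentialPDF a) := (measurable_exponentialPDFReal a).ennreal_ofReal
  have h : expMeasure a = volume.withDensity (exponentialPDF a) := rfl
  rw [h, integral_withDensity_eq_integral_toReal_smul hm (ae_of_all _ fun x => by
    simp [exponentialPDF]), ← integral_indicator measurableSet_Ioi]
  refine integral_congr_ae ?_
  filter_upwards [Measure.ae_ne volume (0 : ℝ)] with x hx
  rcases lt_or_gt_of_ne hx with h | h
  · rw [exponentialPDF_of_neg h, indicator_of_notMem (by simpa using h.le)]; simp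
  · rw [exponentialPDF_of_nonneg h.le, indicator_of_mem (by simpa using h),
      ENNReal.toReal_ofReal (by positivity)]

lemma expMeasure_Ioi {a : ℝ} (ha : 0 < a) {x : ℝ} (hx : 0 ≤ x) :
    (expMeasure a).real (Ioi x) = Real.exp (-(a * x)) := by
  have := isProbabilityMeasure_expMeasure ha
  rw [← compl_Iic, probReal_compl_eq_one_sub measurableSet_Iic, ← cdf_eq_real,
    cdf_expMeasure_eq ha, if_pos hx]
  ring

lemma expMeasure_Ici {a : ℝ} (ha : 0 < a) {x : ℝ} (hx : 0 ≤ x) :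
    (expMeasure a).real (Ici x) = Real.exp (-(a * x)) := by
  have hd : expMeasure a = volume.withDensity (exponentialPDF a) := rfl
  have : NullSingletonClass (expMeasure a) := by rw [hd]; infer_instance
  rw [← expMeasure_Ioi ha hx]
  exact (measureReal_congr Ioi_ae_eq_Ici).symm

end ExponentialLaw

/-! ### Law of the serving distance and its joint law with the interference loss. -/

section Network

variable {Ω : Type*} {lam p α τ : ℝ} {z : ℕ → Ω → ℝ} {act : ℕ → Ω → Bool} {H : Ω → ℝ}
  {G : ℕ → Ω → ℝ}

lemma servingDist_nonneg (ω : Ω) : 0 ≤ servingDist z ω := Real.iInf_nonneg fun _ => abs_nonneg _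

variable [MeasurableSpace Ω] {μ : Measure Ω}

lemma IsNetwork.indep_loc_act (hnet : IsNetwork μ lam p z act H G) :
    IndepFun (fun ω i => z i ω) (fun ω i => act i ω) μ :=
  hnet.indep_loc_marks.comp measurable_id measurable_fst

lemma IsNetwork.measurable_servingDist (hnet : IsNetwork μ lam p z act H G) :
    Measurable (servingDist z) :=
  RSUCoverage.measurable_servingDist hnet.measurable_loc

/-- The exceptional null set must not depend on `s`, since `s` will be the random serving distance.
Countably many `s = 1 / (n + 1)` suffice, because the tail decreases in `s`. -/
lemma IsNetwork.ae_tailLoss (hnet : IsNetwork μ lam p z act H G) (hα : 1 < α) :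
    ∀ᵐ ω ∂μ, ∀ s > 0, ∫⁻ y, ENNReal.ofReal (tailLoss α s y) ∂(rsuProcess z ω) ≠ ∞ := by
  have h : ∀ n : ℕ, ∀ᵐ ω ∂μ,
      ∫⁻ y, ENNReal.ofReal (tailLoss α (1 / (n + 1)) y) ∂(rsuProcess z ω) < ∞ := fun n => by
    have hm : Measurable fun y => ENNReal.ofReal (tailLoss α (1 / (n + 1 : ℝ)) y) :=
      measurable_tailLoss.ennreal_ofReal
    refine ae_lt_top ((Measure.measurable_lintegral hm).comp hnet.poisson.measurable) ?_
    refine (hnet.poisson.lintegral_lintegral hm).trans_ne (ENNReal.mul_ne_top (by simp) ?_)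
    exact lintegral_tailLoss_ne_top hα (by positivity)
  filter_upwards [ae_all_iff.2 h] with ω hω s hs
  obtain ⟨n, hn⟩ := exists_nat_one_div_lt hs
  refine ne_top_of_le_ne_top (hω n).ne (lintegral_mono fun y => ENNReal.ofReal_le_ofReal ?_)
  unfold tailLoss
  split_ifs with h1 h2
  · exact le_rfl
  · exact absurd (hn.trans h1) h2
  · positivity
  · exact le_rfl

/-- Contribution of the interferers farther away than `r` to `-log P_c`. -/
def logLoss (α τ : ℝ) (z : ℕ → Ω → ℝ) (act : ℕ → Ω → Bool) (r : ℝ) (ω : Ω) : ℝ≥0∞ :=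
  ∫⁻ y, ENNReal.ofReal (pathLoss α τ (y / r)) ∂(activeProcess z act ω)

lemma IsNetwork.measurable_logLoss (hnet : IsNetwork μ lam p z act H G) {r : Ω → ℝ}
    (hr : Measurable r) : Measurable fun ω => logLoss α τ z act (r ω) ω := by
  simp only [logLoss, lintegral_activeProcess]
  refine Measurable.tsum fun i => Measurable.ite
    (hnet.measurable_act i (measurableSet_singleton true)) ?_ measurable_const
  exact (measurable_pathLoss.comp ((hnet.measurable_loc i).div hr)).ennreal_ofReal

variable [IsProbabilityMeasure μ]

/-- The void probability is the shot-noise formula for `g = 0`. -/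
lemma IsNetwork.measureReal_le_servingDist (hnet : IsNetwork μ lam p z act H G) (hlam : 0 < lam)
    (hp : 0 ≤ p) {s : ℝ} (hs : 0 ≤ s) :
    μ.real {ω | s ≤ servingDist z ω} = Real.exp (-(2 * lam * s)) := by
  have h := integral_indicator_exp_active hnet.poisson hlam.le hp hnet.measurable_loc
    hnet.measurable_act hnet.act_prob hnet.indep_act hnet.indep_loc_act hs 0
    (g := fun _ => 0) measurable_const (by simp) (by simp) (by simp)
  have hms : MeasurableSet {ω | s ≤ servingDist z ω} :=
    measurableSet_le measurable_const hnet.measurable_servingDist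
  simp only [Complex.ofReal_zero, zero_mul, Complex.exp_zero, sub_self, integral_zero, mul_zero,
    mul_one, integral_indicator_const _ hms, Complex.real_smul] at h
  exact_mod_cast h

/-- The serving distance is exponentially distributed. -/
lemma IsNetwork.map_servingDist (hnet : IsNetwork μ lam p z act H G) (hlam : 0 < lam)
    (hp : 0 ≤ p) : μ.map (servingDist z) = expMeasure (2 * lam) := by
  have hm := hnet.measurable_servingDist
  have h2 : 0 < 2 * lam := by linarith
  have := isProbabilityMeasure_expMeasure h2
  have := Measure.isProbabilityMeasure_map hm.aemeasurable (μ := μ)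
  refine Measure.ext_of_Ici _ _ fun s => ?_
  have key : (μ.map (servingDist z)).real (Ici s) = (expMeasure (2 * lam)).real (Ici s) := by
    have hpos : ∀ s, 0 ≤ s →
        (μ.map (servingDist z)).real (Ici s) = (expMeasure (2 * lam)).real (Ici s) := by
      intro s hs
      rw [expMeasure_Ici h2 hs, ← hnet.measureReal_le_servingDist hlam hp hs,
        map_measureReal_apply hm measurableSet_Ici]
      rfl
    rcases le_total 0 s with hs | hs
    · exact hpos s hs
    · have e1 : (expMeasure (2 * lam)).real (Ici s) = 1 := by
        refine le_antisymm measureReal_le_one ?_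
        rw [← show (expMeasure (2 * lam)).real (Ici 0) = 1 by simp [expMeasure_Ici h2 le_rfl]]
        exact measureReal_mono (Ici_subset_Ici.2 hs)
      have e2 : (μ.map (servingDist z)).real (Ici s) = 1 := by
        refine le_antisymm measureReal_le_one ?_
        rw [← show (μ.map (servingDist z)).real (Ici 0) = 1 by
          simp [hpos 0 le_rfl, expMeasure_Ici h2 le_rfl]]
        exact measureReal_mono (Ici_subset_Ici.2 hs)
      rw [e1, e2]
  exact (measureReal_eq_measureReal_iff).1 key

lemma IsNetwork.integral_comp_servingDist {E : Type*} [NormedAddCommGroup E] [NormedSpace ℝ E]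
    (hnet : IsNetwork μ lam p z act H G) (hlam : 0 < lam) (hp : 0 ≤ p) {F : ℝ → E}
    (hF : StronglyMeasurable F) :
    ∫ ω, F (servingDist z ω) ∂μ = ∫ r in Ioi 0, fR lam r • F r := by
  rw [← integral_map hnet.measurable_servingDist.aemeasurable hF.aestronglyMeasurable,
    hnet.map_servingDist hlam hp, integral_expMeasure (by linarith)]
  rfl

lemma IsNetwork.ae_servingDist_pos (hnet : IsNetwork μ lam p z act H G) (hlam : 0 < lam)
    (hp : 0 ≤ p) : ∀ᵐ ω ∂μ, 0 < servingDist z ω := by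
  have h2 : 0 < 2 * lam := by linarith
  have := isProbabilityMeasure_expMeasure h2
  have h : ∀ᵐ r ∂(μ.map (servingDist z)), r ∈ Ioi (0 : ℝ) := by
    change Ioi (0 : ℝ) ∈ ae (μ.map (servingDist z))
    rw [hnet.map_servingDist hlam hp, mem_ae_iff_prob_eq_one measurableSet_Ioi]
    have := expMeasure_Ioi h2 le_rfl
    simpa [measureReal_def, ENNReal.toReal_eq_one_iff] using this
  exact ae_of_ae_map hnet.measurable_servingDist.aemeasurable h

/-- Exponent of the characteristic function of the shot noise, per unit of serving distance. -/
def logCharFun (lam p α τ t : ℝ) : ℂ :=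
  lam * p * ∫ y, (Complex.exp (t * pathLoss α τ y * Complex.I) - 1)

/-- The loss beyond `r ≥ s` ignores the ball of radius `s`, so the general formula applies; the
change of variable `y ↦ y / r` extracts the factor `r` in the exponent. -/
lemma IsNetwork.integral_indicator_exp_logLoss (hnet : IsNetwork μ lam p z act H G)
    (hlam : 0 < lam) (hp : 0 ≤ p) (hα : 1 < α) (hτ : 0 ≤ τ) {s r : ℝ} (hs : 0 ≤ s) (hsr : s ≤ r)
    (hr : 0 < r) (t : ℝ) :
    ∫ ω in {ω | s ≤ servingDist z ω}, Complex.exp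
        (t * (logLoss α τ z act r ω).toReal * Complex.I) ∂μ =
      Real.exp (-(2 * lam * s)) * Complex.exp (r * logCharFun lam p α τ t) := by
  have hms : MeasurableSet {ω | s ≤ servingDist z ω} :=
    measurableSet_le measurable_const hnet.measurable_servingDist
  have h := integral_indicator_exp_active hnet.poisson hlam.le hp hnet.measurable_loc
    hnet.measurable_act hnet.act_prob hnet.indep_act hnet.indep_loc_act hs t
    (g := fun y => ENNReal.ofReal (pathLoss α τ (y / r)))
    (measurable_pathLoss.comp (by fun_prop)).ennreal_ofReal (by simp)
    (lintegral_pathLoss_ne_top (by linarith) hτ hr (lintegral_tailLoss_ne_top hα hr)) (by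
      intro y hy
      rw [pathLoss_div_eq hr, if_neg (by linarith), ENNReal.ofReal_zero])
  rw [integral_indicator hms] at h
  refine h.trans ?_
  simp only [ENNReal.toReal_ofReal (pathLoss_nonneg hτ)]
  rw [Measure.integral_comp_div (fun y => Complex.exp (t * pathLoss α τ y * Complex.I) - 1) r,
    abs_of_pos hr, logCharFun, Complex.real_smul, mul_left_comm]

/-- The same factor `exp (r * logCharFun)` appears on `s ≤ R` and on `r ≤ R`. Subtracting the two
shows that the loss beyond `r` behaves on the cell as if independent of it. -/
lemma IsNetwork.setIntegral_exp_logLoss (hnet : IsNetwork μ lam p z act H G)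
    (hlam : 0 < lam) (hp : 0 ≤ p) (hα : 1 < α) (hτ : 0 ≤ τ) {s r : ℝ} (hs : 0 ≤ s) (hsr : s < r)
    (t : ℝ) :
    ∫ ω in {ω | s ≤ servingDist z ω ∧ servingDist z ω < r}, Complex.exp
        (t * (logLoss α τ z act r ω).toReal * Complex.I) ∂μ =
      ∫ _ in {ω | s ≤ servingDist z ω ∧ servingDist z ω < r},
        Complex.exp (r * logCharFun lam p α τ t) ∂μ := by
  have hr := hs.trans_lt hsr
  have hm := hnet.measurable_servingDist
  have hmr : MeasurableSet {ω | r ≤ servingDist z ω} := measurableSet_le measurable_const hm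
  have hsub : {ω | r ≤ servingDist z ω} ⊆ {ω | s ≤ servingDist z ω} := fun ω (h : r ≤ _) =>
    show s ≤ _ from hsr.le.trans h
  have hset : {ω | s ≤ servingDist z ω ∧ servingDist z ω < r} =
      {ω | s ≤ servingDist z ω} \ {ω | r ≤ servingDist z ω} := by
    ext ω; simp
  have hmeas : Measurable fun ω => logLoss α τ z act r ω := hnet.measurable_logLoss measurable_const
  have hint : Integrable (fun ω => Complex.exp
      (t * (logLoss α τ z act r ω).toReal * Complex.I)) μ :=
    Integrable.of_bound (Measurable.aestronglyMeasurable (by fun_prop)) 1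
      (ae_of_all _ fun ω => (norm_exp_ofReal_mul_I_mul _ _).le)
  rw [hset, setIntegral_sdiff hmr hint.integrableOn hsub, setIntegral_sdiff hmr
    (integrable_const _).integrableOn hsub,
    hnet.integral_indicator_exp_logLoss hlam hp hα hτ hs hsr.le hr,
    hnet.integral_indicator_exp_logLoss hlam hp hα hτ hr.le le_rfl hr]
  simp only [setIntegral_const, hnet.measureReal_le_servingDist hlam hp hs,
    hnet.measureReal_le_servingDist hlam hp hr.le, Complex.real_smul]

lemma IsNetwork.integral_gridAbove (hnet : IsNetwork μ lam p z act H G)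
    (hlam : 0 < lam) (hp : 0 ≤ p) (hα : 1 < α) (hτ : 0 ≤ τ) (t : ℝ) (n : ℕ) {h : ℝ → ℂ}
    (hh : Measurable h) (hh1 : ∀ r, ‖h r‖ ≤ 1)
    (hc : ∀ r : ℝ, 0 ≤ r → ‖Complex.exp (r * logCharFun lam p α τ t)‖ ≤ 1) :
    ∫ ω, h (gridAbove n (servingDist z ω)) * Complex.exp
        (t * (logLoss α τ z act (gridAbove n (servingDist z ω)) ω).toReal * Complex.I) ∂μ =
      ∫ ω, h (gridAbove n (servingDist z ω)) *
        Complex.exp (gridAbove n (servingDist z ω) * logCharFun lam p α τ t) ∂μ := by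
  have hm := hnet.measurable_servingDist
  have hg := (measurable_gridAbove n).comp hm
  have hL : Measurable fun ω => logLoss α τ z act (gridAbove n (servingDist z ω)) ω :=
    hnet.measurable_logLoss hg
  have hhg := hh.comp hg
  simp only [Function.comp_def] at hhg hg
  -- On these half-open cells the floor plus one in `gridAbove` always selects the upper endpoint,
  -- as the exact cell identity requires.
  set A : ℕ → Set Ω := fun k => {ω | (k : ℝ) / (n + 1) ≤ servingDist z ω ∧
    servingDist z ω < (k + 1) / (n + 1)} with hA
  have hAm : ∀ k, MeasurableSet (A k) := fun k =>
    (measurableSet_le measurable_const hm).inter (measurableSet_lt hm measurable_const)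
  have hAk : ∀ k ω, ω ∈ A k ↔ ⌊((n : ℝ) + 1) * servingDist z ω⌋₊ = k := by
    intro k ω
    have h0 := servingDist_nonneg (z := z) ω
    rw [Nat.floor_eq_iff (by positivity)]
    simp only [hA, mem_ofPred_eq]
    rw [div_le_iff₀ (by positivity), lt_div_iff₀ (by positivity), mul_comm (servingDist z ω)]
  have hAd : Pairwise (Function.onFun Disjoint A) := fun j k hjk =>
    Set.disjoint_left.2 fun ω hj hk => hjk (((hAk j ω).1 hj).symm.trans ((hAk k ω).1 hk))
  have hAu : ⋃ k, A k = univ := eq_univ_of_forall fun ω => mem_iUnion.2 ⟨_, (hAk _ ω).2 rfl⟩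
  have hgrid : ∀ k, ∀ ω ∈ A k, gridAbove n (servingDist z ω) = (k + 1) / (n + 1) :=
    fun k ω hω => by rw [gridAbove, (hAk k ω).1 hω]
  have hi1 : Integrable (fun ω => h (gridAbove n (servingDist z ω)) * Complex.exp
      (t * (logLoss α τ z act (gridAbove n (servingDist z ω)) ω).toReal * Complex.I)) μ := by
    refine Integrable.of_bound (Measurable.aestronglyMeasurable (by fun_prop)) 1
      (ae_of_all _ fun ω => ?_)
    rw [norm_mul, norm_exp_ofReal_mul_I_mul, mul_one]
    exact hh1 _
  have hi2 : Integrable (fun ω => h (gridAbove n (servingDist z ω)) *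
        Complex.exp (gridAbove n (servingDist z ω) * logCharFun lam p α τ t)) μ := by
    refine Integrable.of_bound (Measurable.aestronglyMeasurable (by fun_prop)) 1
      (ae_of_all _ fun ω => ?_)
    rw [norm_mul]
    exact mul_le_one₀ (hh1 _) (norm_nonneg _)
      (hc _ ((servingDist_nonneg ω).trans (lt_gridAbove n _).le))
  have s1 := hasSum_integral_iUnion hAm hAd hi1.integrableOn
  have s2 := hasSum_integral_iUnion hAm hAd hi2.integrableOn
  rw [hAu, setIntegral_univ] at s1 s2
  refine s1.unique ?_
  convert s2 using 1
  funext k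
  have e1 : ∀ ω ∈ A k, h (gridAbove n (servingDist z ω)) * Complex.exp
      (t * (logLoss α τ z act (gridAbove n (servingDist z ω)) ω).toReal * Complex.I) =
      h ((k + 1) / (n + 1)) * Complex.exp
        (t * (logLoss α τ z act ((k + 1) / (n + 1)) ω).toReal * Complex.I) :=
    fun ω hω => by rw [hgrid k ω hω]
  have e2 : ∀ ω ∈ A k, h (gridAbove n (servingDist z ω)) *
      Complex.exp (gridAbove n (servingDist z ω) * logCharFun lam p α τ t) =
      h ((k + 1) / (n + 1)) *
        Complex.exp (((k + 1) / (n + 1) : ℝ) * logCharFun lam p α τ t) :=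
    fun ω hω => by rw [hgrid k ω hω]
  rw [setIntegral_congr_fun (hAm k) e1, setIntegral_congr_fun (hAm k) e2, integral_const_mul,
    integral_const_mul]
  congr 1
  exact hnet.setIntegral_exp_logLoss hlam hp hα hτ (by positivity) (by gcongr; linarith) t

/-- Finiteness of the limit is included because `toReal` is continuous only at finite values. -/
lemma IsNetwork.tendsto_logLoss_gridAbove (hnet : IsNetwork μ lam p z act H G) (hlam : 0 < lam)
    (hp : 0 ≤ p) (hα : 1 < α) (hτ : 0 ≤ τ) :
    ∀ᵐ ω ∂μ, logLoss α τ z act (servingDist z ω) ω ≠ ∞ ∧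
      Tendsto (fun n => logLoss α τ z act (gridAbove n (servingDist z ω)) ω) atTop
        (𝓝 (logLoss α τ z act (servingDist z ω) ω)) := by
  filter_upwards [hnet.ae_servingDist_pos hlam hp, hnet.ae_tailLoss hα] with ω hω hω'
  have hfin : ∫⁻ y, ENNReal.ofReal (tailLoss α (servingDist z ω) y) ∂(activeProcess z act ω) ≠ ∞ :=
    ne_top_of_le_ne_top (hω' _ hω) (lintegral_mono' (activeProcess_le ω) le_rfl)
  exact ⟨lintegral_pathLoss_ne_top (by linarith) hτ hω hfin,
    tendsto_lintegral_pathLoss (by linarith) hτ hω hfin (fun n => lt_gridAbove n _)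
      (fun n => gridAbove_le_add_one n hω.le) (tendsto_gridAbove hω.le)⟩

/-- Joint law of the serving distance and of the interference term of `-log P_c`. -/
lemma IsNetwork.integral_mul_exp_logLoss (hnet : IsNetwork μ lam p z act H G)
    (hlam : 0 < lam) (hp : 0 ≤ p) (hα : 1 < α) (hτ : 0 ≤ τ) (t : ℝ) {h : ℝ → ℂ}
    (hh : ContinuousOn h (Ioi 0)) (hhm : Measurable h) (hh1 : ∀ r, ‖h r‖ ≤ 1)
    (hc : ∀ r : ℝ, 0 ≤ r → ‖Complex.exp (r * logCharFun lam p α τ t)‖ ≤ 1) :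
    ∫ ω, h (servingDist z ω) * Complex.exp
        (t * (logLoss α τ z act (servingDist z ω) ω).toReal * Complex.I) ∂μ =
      ∫ ω, h (servingDist z ω) * Complex.exp (servingDist z ω * logCharFun lam p α τ t) ∂μ := by
  have hm := hnet.measurable_servingDist
  have hg := fun n => (measurable_gridAbove n).comp hm
  have hL := fun n => hnet.measurable_logLoss (α := α) (τ := τ) (hg n)
  have hhg := fun n => hhm.comp (hg n)
  simp only [Function.comp_def] at hhg hg hL
  have hlim : ∀ᵐ ω ∂μ, Tendsto (fun n => h (gridAbove n (servingDist z ω))) atTop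
      (𝓝 (h (servingDist z ω))) := by
    filter_upwards [hnet.ae_servingDist_pos hlam hp] with ω hω
    exact (hh.continuousAt (Ioi_mem_nhds hω)).tendsto.comp (tendsto_gridAbove hω.le)
  have l1 : Tendsto (fun n => ∫ ω, h (gridAbove n (servingDist z ω)) * Complex.exp
        (t * (logLoss α τ z act (gridAbove n (servingDist z ω)) ω).toReal * Complex.I) ∂μ) atTop
      (𝓝 (∫ ω, h (servingDist z ω) * Complex.exp
        (t * (logLoss α τ z act (servingDist z ω) ω).toReal * Complex.I) ∂μ)) := by
    refine tendsto_integral_of_dominated_convergence (fun _ => 1) (fun n => ?_)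
      (integrable_const _) (fun n => ae_of_all _ fun ω => ?_) ?_
    · have h1 := hhg n
      have h2 := hL n
      exact Measurable.aestronglyMeasurable (by fun_prop)
    · rw [norm_mul, norm_exp_ofReal_mul_I_mul, mul_one]
      exact hh1 _
    · filter_upwards [hlim, hnet.tendsto_logLoss_gridAbove hlam hp hα hτ] with ω h1 h2
      refine h1.mul ?_
      have hcont : Continuous fun x : ℝ => Complex.exp (t * x * Complex.I) := by fun_prop
      exact (hcont.tendsto _).comp ((ENNReal.tendsto_toReal h2.1).comp h2.2)
  have l2 : Tendsto (fun n => ∫ ω, h (gridAbove n (servingDist z ω)) *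
        Complex.exp (gridAbove n (servingDist z ω) * logCharFun lam p α τ t) ∂μ) atTop
      (𝓝 (∫ ω, h (servingDist z ω) *
        Complex.exp (servingDist z ω * logCharFun lam p α τ t) ∂μ)) := by
    refine tendsto_integral_of_dominated_convergence (fun _ => 1) (fun n => ?_)
      (integrable_const _) (fun n => ae_of_all _ fun ω => ?_) ?_
    · have h1 := hhg n
      have h2 := hg n
      exact Measurable.aestronglyMeasurable (by fun_prop)
    · rw [norm_mul]
      exact mul_le_one₀ (hh1 _) (norm_nonneg _)
        (hc _ ((servingDist_nonneg ω).trans (lt_gridAbove n _).le))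
    · filter_upwards [hlim] with ω h1
      refine h1.mul ?_
      have hcont : Continuous fun x : ℝ => Complex.exp (x * logCharFun lam p α τ t) := by fun_prop
      exact (hcont.tendsto _).comp (tendsto_gridAbove (servingDist_nonneg ω))
  refine tendsto_nhds_unique l1 (l2.congr fun n => ?_)
  exact (hnet.integral_gridAbove hlam hp hα hτ t n hhm hh1 hc).symm

end Network

/-! ### Bounds for the kernels and evaluation of the exponent. -/

section Kernels

variable {α τ t : ℝ}

lemma log_one_add_mul_mem (hτ : 0 ≤ τ) {y : ℝ} (hy : 0 ≤ y) :
    0 ≤ Real.log (1 + τ * y) ∧ Real.log (1 + τ * y) ≤ τ * y := by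
  have h : 0 ≤ τ * y := by positivity
  refine ⟨Real.log_nonneg (by linarith), ?_⟩
  have := Real.log_le_sub_one_of_pos (x := 1 + τ * y) (by linarith)
  linarith

lemma mul_rpow_neg_eta {y : ℝ} (hy : 0 < y) : y * y ^ (-eta α) = y ^ (-(1 / α)) := by
  nth_rewrite 1 [← Real.rpow_one y]
  rw [← Real.rpow_add hy, eta]
  ring_nf

lemma measurable_cosKernel : Measurable (Function.uncurry (cosKernel α τ)) := by
  unfold cosKernel Function.uncurry; fun_prop

lemma measurable_sinKernel : Measurable (Function.uncurry (sinKernel α τ)) := by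
  unfold sinKernel Function.uncurry; fun_prop

lemma cosKernel_nonneg {y : ℝ} (hy : 0 ≤ y) : 0 ≤ cosKernel α τ t y :=
  mul_nonneg (sub_nonneg.2 (Real.cos_le_one _)) (Real.rpow_nonneg hy _)

/-- From `1 - cos u ≤ u² / 2` and `log (1 + τy) ≤ τy` one gets a factor `y²`; one power is discarded
using `y ≤ 1`, the other reduces `y ^ (-η)` to the integrable `y ^ (-1/α)`. -/
lemma cosKernel_le (hτ : 0 ≤ τ) {y : ℝ} (hy : 0 < y) (hy1 : y ≤ 1) :
    cosKernel α τ t y ≤ (t * τ) ^ 2 / 2 * y ^ (-(1 / α)) := by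
  obtain ⟨h0, h1⟩ := log_one_add_mul_mem hτ hy.le
  have h2 := Real.one_sub_sq_div_two_le_cos (x := t * Real.log (1 + τ * y))
  rw [← mul_rpow_neg_eta hy, cosKernel, ← mul_assoc]
  gcongr
  have h3 : Real.log (1 + τ * y) ^ 2 ≤ τ ^ 2 * y := by
    calc Real.log (1 + τ * y) ^ 2 ≤ (τ * y) ^ 2 := by gcongr
      _ = τ ^ 2 * (y * y) := by ring
      _ ≤ τ ^ 2 * (1 * y) := by gcongr
      _ = τ ^ 2 * y := by ring
  nlinarith [mul_le_mul_of_nonneg_left h3 (sq_nonneg t)]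

lemma abs_sinKernel_le (hτ : 0 ≤ τ) {y : ℝ} (hy : 0 < y) :
    |sinKernel α τ t y| ≤ |t| * τ * y ^ (-(1 / α)) := by
  obtain ⟨h0, h1⟩ := log_one_add_mul_mem hτ hy.le
  rw [← mul_rpow_neg_eta hy, sinKernel, ← mul_assoc, abs_mul,
    abs_of_nonneg (Real.rpow_nonneg hy.le _)]
  gcongr
  refine (Real.abs_sin_le_abs).trans ?_
  rw [abs_mul, abs_of_nonneg h0, mul_assoc]
  gcongr

lemma integrableOn_rpow_neg_inv (hα : 1 < α) :
    IntegrableOn (fun y : ℝ => y ^ (-(1 / α))) (Ioc 0 1) := by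
  rw [← intervalIntegrable_iff_integrableOn_Ioc_of_le zero_le_one]
  refine intervalIntegral.intervalIntegrable_rpow' ?_
  have : 1 / α < 1 := by rw [div_lt_one (by linarith)]; exact hα
  linarith

lemma integrableOn_cosKernel (hα : 1 < α) (hτ : 0 ≤ τ) :
    IntegrableOn (cosKernel α τ t) (Ioc 0 1) := by
  refine ((integrableOn_rpow_neg_inv hα).const_mul ((t * τ) ^ 2 / 2)).mono'
    (measurable_cosKernel.of_uncurry_left).aestronglyMeasurable ?_
  filter_upwards [ae_restrict_mem measurableSet_Ioc] with y hy
  rw [Real.norm_of_nonneg (cosKernel_nonneg hy.1.le)]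
  exact cosKernel_le hτ hy.1 hy.2

lemma integrableOn_sinKernel (hα : 1 < α) (hτ : 0 ≤ τ) :
    IntegrableOn (sinKernel α τ t) (Ioc 0 1) := by
  refine ((integrableOn_rpow_neg_inv hα).const_mul (|t| * τ)).mono'
    (measurable_sinKernel.of_uncurry_left).aestronglyMeasurable ?_
  filter_upwards [ae_restrict_mem measurableSet_Ioc] with y hy
  exact abs_sinKernel_le hτ hy.1

lemma integral_cosKernel_nonneg : 0 ≤ ∫ y in (0 : ℝ)..1, cosKernel α τ t y :=
  intervalIntegral.integral_nonneg zero_le_one fun _ hy => cosKernel_nonneg hy.1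

lemma abs_integral_sinKernel_le (hα : 1 < α) (hτ : 0 ≤ τ) :
    |∫ y in (0 : ℝ)..1, sinKernel α τ t y| ≤
      |t| * (τ * ∫ y in Ioc (0 : ℝ) 1, y ^ (-(1 / α))) := by
  rw [intervalIntegral.integral_of_le zero_le_one, ← mul_assoc, ← integral_const_mul,
    ← Real.norm_eq_abs]
  refine norm_integral_le_of_norm_le ((integrableOn_rpow_neg_inv hα).const_mul _) ?_
  filter_upwards [ae_restrict_mem measurableSet_Ioc] with y hy
  exact abs_sinKernel_le hτ hy.1

lemma stronglyMeasurable_integral_cosKernel :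
    StronglyMeasurable fun t => ∫ y in (0 : ℝ)..1, cosKernel α τ t y := by
  simp only [intervalIntegral.integral_of_le zero_le_one]
  exact StronglyMeasurable.integral_prod_right' (f := Function.uncurry (cosKernel α τ))
    measurable_cosKernel.stronglyMeasurable

lemma stronglyMeasurable_integral_sinKernel :
    StronglyMeasurable fun t => ∫ y in (0 : ℝ)..1, sinKernel α τ t y := by
  simp only [intervalIntegral.integral_of_le zero_le_one]
  exact StronglyMeasurable.integral_prod_right' (f := Function.uncurry (sinKernel α τ))
    measurable_sinKernel.stronglyMeasurable

/-- Two lower bounds combine: `1 - cos u ≥ 2u² / π²` for `|u| ≤ π`, and `log (1 + τy) ≥ τy / (1 +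
τy) ≥ τy / (1 + τ)` for `y ≤ 1`. -/
lemma le_cosKernel (hτ : 0 < τ) (ht : 0 < t) {y : ℝ} (hy : 0 < y) (hy1 : y ≤ 1)
    (hyt : t * (τ * y) ≤ Real.pi) :
    2 / Real.pi ^ 2 * (t * (τ / (1 + τ))) ^ 2 * y ^ (1 - 1 / α) ≤ cosKernel α τ t y := by
  obtain ⟨h0, h1⟩ := log_one_add_mul_mem hτ.le hy.le
  have hlog : τ / (1 + τ) * y ≤ Real.log (1 + τ * y) := by
    have hpos : 0 < 1 + τ * y := by positivity
    refine le_trans ?_ (Real.one_sub_inv_le_log_of_pos hpos)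
    have hle : (1 + τ * y)⁻¹ * (τ * y) = 1 - (1 + τ * y)⁻¹ := by field_simp; ring
    rw [← hle, div_mul_eq_mul_div, inv_mul_eq_div]
    gcongr
    nlinarith
  have hcos : 2 / Real.pi ^ 2 * (t * Real.log (1 + τ * y)) ^ 2 ≤
      1 - Real.cos (t * Real.log (1 + τ * y)) := by
    have := Real.cos_le_one_sub_mul_cos_sq (x := t * Real.log (1 + τ * y)) (by
      rw [abs_of_nonneg (by positivity)]
      exact (mul_le_mul_of_nonneg_left h1 ht.le).trans hyt)
    linarith
  have hpow : y ^ (1 - 1 / α) = y ^ 2 * y ^ (-eta α) := by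
    rw [pow_two, mul_assoc, mul_rpow_neg_eta hy]
    nth_rewrite 2 [← Real.rpow_one y]
    rw [← Real.rpow_add hy]
    ring_nf
  rw [hpow, cosKernel, ← mul_assoc]
  gcongr
  refine le_trans ?_ hcos
  rw [mul_assoc, ← mul_pow, mul_assoc]
  gcongr

/-- Growth of the exponent of `fr`. -/
lemma exists_le_integral_cosKernel (hα : 1 < α) (hτ : 0 < τ) :
    ∃ c > 0, ∀ t, 1 ≤ t → c * t ^ (1 / α) ≤ ∫ y in (0 : ℝ)..1, cosKernel α τ t y := by
  -- On `y ≤ δ / t` with `t ≥ 1` both `y ≤ 1` and `t τ y ≤ π` hold. There the quadratic bound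
  -- integrates to a multiple of `t² (δ / t) ^ (2 - 1/α)`, that is, of `t ^ (1/α)`.
  set δ := min 1 (Real.pi / τ) with hδ
  have hδ0 : 0 < δ := lt_min one_pos (by positivity)
  have hinv : 1 / α < 1 := by rw [div_lt_one (by linarith)]; exact hα
  have he : 0 < 1 - 1 / α + 1 := by linarith
  refine ⟨2 / Real.pi ^ 2 * (τ / (1 + τ)) ^ 2 * (δ ^ (1 - 1 / α + 1) / (1 - 1 / α + 1)),
    by positivity, fun t ht => ?_⟩
  have ht0 : 0 < t := by linarith
  have hb0 : 0 < δ / t := by positivity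
  have hb1 : δ / t ≤ 1 := by
    rw [div_le_one ht0]; exact (min_le_left _ _).trans ht
  have hint : IntegrableOn (fun y : ℝ => y ^ (1 - 1 / α)) (Ioc 0 (δ / t)) := by
    rw [← intervalIntegrable_iff_integrableOn_Ioc_of_le hb0.le]
    exact intervalIntegral.intervalIntegrable_rpow' (by linarith)
  rw [intervalIntegral.integral_of_le zero_le_one]
  calc _ = 2 / Real.pi ^ 2 * (t * (τ / (1 + τ))) ^ 2 * ∫ y in Ioc 0 (δ / t), y ^ (1 - 1 / α) := by
        rw [← intervalIntegral.integral_of_le hb0.le, integral_rpow (Or.inl (by linarith)),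
          Real.zero_rpow he.ne', sub_zero, Real.div_rpow hδ0.le ht0.le,
          show (1 - 1 / α + 1) = 2 - 1 / α by ring, Real.rpow_sub ht0, Real.rpow_two]
        field_simp
    _ = ∫ y in Ioc 0 (δ / t), 2 / Real.pi ^ 2 * (t * (τ / (1 + τ))) ^ 2 * y ^ (1 - 1 / α) :=
        (integral_const_mul _ _).symm
    _ ≤ ∫ y in Ioc 0 (δ / t), cosKernel α τ t y := by
        refine setIntegral_mono_on (hint.const_mul _)
          ((integrableOn_cosKernel hα hτ.le).mono_set (Ioc_subset_Ioc_right hb1))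
          measurableSet_Ioc fun y hy => ?_
        refine le_cosKernel hτ ht0 hy.1 (hy.2.trans hb1) ?_
        have h1 : t * y ≤ δ := by rw [mul_comm, ← le_div_iff₀ ht0]; exact hy.2
        have h2 : δ ≤ Real.pi / τ := min_le_right _ _
        rw [le_div_iff₀ hτ] at h2
        nlinarith
    _ ≤ ∫ y in Ioc 0 1, cosKernel α τ t y := by
        refine setIntegral_mono_set (integrableOn_cosKernel hα hτ.le) ?_
          (Ioc_subset_Ioc_right hb1).eventuallyLE
        filter_upwards [ae_restrict_mem measurableSet_Ioc] with y hy
        exact cosKernel_nonneg hy.1.le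

/-- Substitute `|y| = u ^ (-1/α)`: the factor `2` is symmetry, the Jacobian is `u ^ (-η) / α`, and
`|y| > 1` becomes `u < 1`. The rest of the line contributes nothing since `φ 0 = 0`. -/
lemma integral_comp_pathLoss (hα : 1 < α) {φ : ℝ → ℝ} (hφ : φ 0 = 0) :
    ∫ y, φ (pathLoss α τ y) =
      2 / α * ∫ y in (0 : ℝ)..1, φ (Real.log (1 + τ * y)) * y ^ (-eta α) := by
  have hα0 : 0 < α := by linarith
  have h1 : ∫ y, φ (pathLoss α τ y) = ∫ y, φ (pathLoss α τ |y|) := by simp [pathLoss]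
  rw [h1, integral_comp_abs (f := fun y => φ (pathLoss α τ y)),
    ← integral_comp_rpow_Ioi _ (p := -(1 / α)) (by simp [hα0.ne']),
    intervalIntegral.integral_of_le zero_le_one, integral_Ioc_eq_integral_Ioo,
    div_eq_mul_one_div 2 α, mul_assoc, ← integral_const_mul (1 / α)]
  congr 1
  rw [← integral_indicator measurableSet_Ioi, ← integral_indicator measurableSet_Ioo]
  refine integral_congr_ae (ae_of_all _ fun y => ?_)
  by_cases hy : 0 < y
  · have hpl : pathLoss α τ (y ^ (-(1 / α))) = if y < 1 then Real.log (1 + τ * y) else 0 := by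
      have hp : 0 < y ^ (-(1 / α)) := Real.rpow_pos_of_pos hy _
      have hiff : 1 < y ^ (-(1 / α)) ↔ y < 1 :=
        Real.one_lt_rpow_iff_of_pos hy |>.trans (by
          have : 0 < 1 / α := by positivity
          constructor
          · rintro (⟨_, h⟩ | ⟨h, _⟩)
            · linarith
            · exact h
          · exact fun h => Or.inr ⟨h, by linarith⟩)
      rw [pathLoss, abs_of_pos hp]
      simp only [hiff]
      rw [← Real.rpow_mul hy.le]
      congr 4
      rw [show -(1 / α) * -α = 1 by field_simp, Real.rpow_one]
    rw [indicator_of_mem (by exact hy), hpl, abs_neg, abs_of_pos (by positivity), smul_eq_mul,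
      show -(1 / α) - 1 = -eta α by rw [eta]; ring]
    by_cases hy1 : y < 1
    · rw [if_pos hy1, indicator_of_mem (by exact ⟨hy, hy1⟩)]; ring
    · rw [if_neg hy1, indicator_of_notMem (fun h => hy1 h.2), hφ, mul_zero]
  · rw [indicator_of_notMem (by exact hy), indicator_of_notMem fun h => hy h.1]

lemma logCharFun_eq (lam p : ℝ) (hα : 1 < α) (hτ : 0 ≤ τ) : logCharFun lam p α τ t =
    ((2 * p * lam / α * -∫ y in (0 : ℝ)..1, cosKernel α τ t y : ℝ) : ℂ) +
      ((2 * p * lam / α * ∫ y in (0 : ℝ)..1, sinKernel α τ t y : ℝ) : ℂ) * Complex.I := by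
  have hint : Integrable fun y => Complex.exp (t * pathLoss α τ y * Complex.I) - 1 := by
    refine ((integrable_tailLoss hα one_pos).const_mul (|t| * τ)).mono' ?_
      (ae_of_all _ fun y => ?_)
    · have := measurable_pathLoss (α := α) (τ := τ)
      exact Measurable.aestronglyMeasurable (by fun_prop)
    · refine (norm_exp_sub_one_le _ _).trans ?_
      rw [abs_of_nonneg (pathLoss_nonneg hτ), mul_assoc]
      gcongr
      have := pathLoss_div_le hτ (by linarith : 0 ≤ α) one_pos le_rfl le_rfl (y := y)
      simpa using this
  have hexp : ∀ y, Complex.exp (t * pathLoss α τ y * Complex.I) =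
      Complex.exp ((t * pathLoss α τ y : ℝ) * Complex.I) := fun y => by push_cast; rfl
  rw [logCharFun, ← integral_re_add_im hint]
  simp only [RCLike.re_eq_complex_re, RCLike.im_eq_complex_im, Complex.sub_re, Complex.sub_im,
    hexp, Complex.exp_ofReal_mul_I_re, Complex.exp_ofReal_mul_I_im, Complex.one_re, Complex.one_im,
    sub_zero]
  rw [integral_comp_pathLoss hα (φ := fun x => Real.cos (t * x) - 1) (by simp),
    integral_comp_pathLoss hα (φ := fun x => Real.sin (t * x)) (by simp)]
  have hneg : ∫ y in (0 : ℝ)..1, (Real.cos (t * Real.log (1 + τ * y)) - 1) * y ^ (-eta α) =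
      -∫ y in (0 : ℝ)..1, cosKernel α τ t y := by
    rw [← intervalIntegral.integral_neg]
    refine intervalIntegral.integral_congr fun y _ => ?_
    simp only [cosKernel]; ring
  rw [hneg]
  simp only [sinKernel, RCLike.I_to_complex]
  push_cast
  simp only [Complex.coe_algebraMap]
  ring

end Kernels

/-! ### Absolute convergence of the inner and outer integrals. -/

section Integrands

variable {lam p α τ SNR x t : ℝ}

lemma fr_le_one (hlam : 0 ≤ lam) (hp : 0 ≤ p) (hα : 0 ≤ α) {r : ℝ} (hr : 0 ≤ r) :
    fr lam p α τ t r ≤ 1 := by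
  refine Real.exp_le_one_iff.2 ?_
  rw [neg_mul]
  exact neg_nonpos.2 (mul_nonneg (by positivity) integral_cosKernel_nonneg)

lemma fr_pos {r : ℝ} : 0 < fr lam p α τ t r := Real.exp_pos _

lemma fR_nonneg (hlam : 0 ≤ lam) {r : ℝ} : 0 ≤ fR lam r := by unfold fR; positivity

lemma measurable_fr : Measurable (Function.uncurry (fr lam p α τ)) := by
  have hK := (stronglyMeasurable_integral_cosKernel (α := α) (τ := τ)).measurable
  have := hK.comp (measurable_fst : Measurable (Prod.fst : ℝ × ℝ → ℝ))
  simp only [Function.comp_def] at this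
  unfold fr Function.uncurry
  fun_prop

lemma measurable_fi : Measurable (Function.uncurry (fi lam p α τ)) := by
  have hK := (stronglyMeasurable_integral_sinKernel (α := α) (τ := τ)).measurable
  have := hK.comp (measurable_fst : Measurable (Prod.fst : ℝ × ℝ → ℝ))
  simp only [Function.comp_def] at this
  unfold fi Function.uncurry
  fun_prop

lemma measurable_Theta : Measurable (Function.uncurry (Theta α τ SNR x)) := by
  unfold Theta Function.uncurry
  fun_prop

lemma measurable_fR : Measurable (fR lam) := by
  unfold fR
  fun_prop

lemma measurable_innerIntegrand :
    Measurable (Function.uncurry (innerIntegrand lam p α τ SNR x)) :=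
  (measurable_fr.mul (Real.measurable_sin.comp (measurable_fi.add measurable_Theta))).mul
    (measurable_fR.comp measurable_snd)

lemma stronglyMeasurable_integral_innerIntegrand :
    StronglyMeasurable fun t => ∫ r in Ioi (0 : ℝ), innerIntegrand lam p α τ SNR x t r :=
  StronglyMeasurable.integral_prod_right'
    (f := Function.uncurry (innerIntegrand lam p α τ SNR x))
    measurable_innerIntegrand.stronglyMeasurable

/-- Both factors are exponentials linear in `r`, so the average of `fr` over the serving distance is
explicit; its decay in `t` comes from the growth of the cosine integral. -/
lemma fR_mul_fr (lam p α τ t r : ℝ) : fR lam r * fr lam p α τ t r =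
    2 * lam * Real.exp (-(2 * lam + 2 * p * lam / α * ∫ y in (0 : ℝ)..1, cosKernel α τ t y) * r) := by
  rw [fR, fr, mul_assoc, ← Real.exp_add]
  ring_nf

lemma exponent_pos (hlam : 0 < lam) (hp : 0 ≤ p) (hα : 0 ≤ α) :
    0 < 2 * lam + 2 * p * lam / α * ∫ y in (0 : ℝ)..1, cosKernel α τ t y :=
  add_pos_of_pos_of_nonneg (by linarith) (mul_nonneg (by positivity) integral_cosKernel_nonneg)

lemma integrableOn_fR_mul_fr (hlam : 0 < lam) (hp : 0 ≤ p) (hα : 0 ≤ α) :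
    IntegrableOn (fun r => fR lam r * fr lam p α τ t r) (Ioi 0) := by
  simp only [fR_mul_fr]
  exact (integrableOn_exp_mul_Ioi (neg_neg_of_pos (exponent_pos hlam hp hα)) 0).const_mul _

lemma integral_fR_mul_fr (hlam : 0 < lam) (hp : 0 ≤ p) (hα : 0 ≤ α) :
    ∫ r in Ioi 0, fR lam r * fr lam p α τ t r =
      2 * lam / (2 * lam + 2 * p * lam / α * ∫ y in (0 : ℝ)..1, cosKernel α τ t y) := by
  simp only [fR_mul_fr]
  rw [integral_const_mul, integral_exp_mul_Ioi (neg_neg_of_pos (exponent_pos hlam hp hα)) 0,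
    mul_zero, Real.exp_zero, neg_div_neg_eq, mul_one_div]

lemma exists_integral_fR_mul_fr_le (hlam : 0 < lam) (hp : 0 < p) (hα : 1 < α) (hτ : 0 < τ) :
    ∃ C, ∀ t, 1 ≤ t → ∫ r in Ioi 0, fR lam r * fr lam p α τ t r ≤ C * t ^ (-(1 / α)) := by
  obtain ⟨c, hc, h⟩ := exists_le_integral_cosKernel hα hτ
  have hα0 : 0 < α := by linarith
  refine ⟨2 * lam / (2 * p * lam / α * c), fun t ht => ?_⟩
  have ht0 : 0 < t := by linarith
  rw [integral_fR_mul_fr hlam hp.le hα0.le, Real.rpow_neg ht0.le, ← div_eq_mul_inv, div_div]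
  gcongr
  calc 2 * p * lam / α * c * t ^ (1 / α) = 2 * p * lam / α * (c * t ^ (1 / α)) := by ring
    _ ≤ 2 * p * lam / α * ∫ y in (0 : ℝ)..1, cosKernel α τ t y := by gcongr; exact h t ht
    _ ≤ _ := by linarith

lemma norm_innerIntegrand_le (hlam : 0 ≤ lam) (r : ℝ) :
    ‖innerIntegrand lam p α τ SNR x t r‖ ≤ fR lam r * fr lam p α τ t r := by
  rw [innerIntegrand, mul_right_comm, mul_comm (fr _ _ _ _ _ _), norm_mul,
    Real.norm_of_nonneg (mul_nonneg (fR_nonneg hlam) fr_pos.le)]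
  exact mul_le_of_le_one_right (mul_nonneg (fR_nonneg hlam) fr_pos.le) (Real.abs_sin_le_one _)

lemma integrableOn_innerIntegrand (hlam : 0 < lam) (hp : 0 ≤ p) (hα : 0 ≤ α) :
    IntegrableOn (innerIntegrand lam p α τ SNR x t) (Ioi 0) :=
  (integrableOn_fR_mul_fr hlam hp hα).mono'
    measurable_innerIntegrand.of_uncurry_left.aestronglyMeasurable
    (ae_of_all _ fun r => norm_innerIntegrand_le hlam.le r)

lemma integrableOn_div_of_decay (hα : 0 < α) {g : ℝ → ℝ} (hg : StronglyMeasurable g) {C : ℝ}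
    (hC : ∀ t, 1 ≤ t → |g t| ≤ C * t ^ (-(1 / α))) : IntegrableOn (fun t => g t / t) (Ioi 1) := by
  have h1 : -(1 / α) - 1 < -1 := by have : 0 < 1 / α := by positivity
                                    linarith
  refine ((integrableOn_Ioi_rpow_of_lt h1 one_pos).const_mul C).mono'
    (hg.measurable.div measurable_id).aestronglyMeasurable ?_
  filter_upwards [ae_restrict_mem measurableSet_Ioi] with t ht
  have ht0 : 0 < t := one_pos.trans ht
  rw [norm_div, Real.norm_of_nonneg ht0.le, div_le_iff₀ ht0, Real.rpow_sub_one ht0.ne',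
    mul_assoc, div_mul_cancel₀ _ ht0.ne']
  exact hC t (le_of_lt ht)

/-- By `|sin u| ≤ |u|`, and since the phase is at most `t` times a combination of `r`, `r ^ α` and
`1`, the constant is a finite sum of moments of the exponential law. This cancels `1 / t` near the
origin. -/
lemma exists_abs_integral_innerIntegrand_le (hlam : 0 < lam) (hp : 0 ≤ p) (hα : 1 < α)
    (hτ : 0 ≤ τ) (hSNR : 0 ≤ SNR) :
    ∃ C, ∀ t, 0 < t → |∫ r in Ioi 0, innerIntegrand lam p α τ SNR x t r| ≤ C * t := by
  have hα0 : 0 < α := by linarith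
  set M := τ * ∫ y in Ioc (0 : ℝ) 1, y ^ (-(1 / α))
  set b : ℝ → ℝ := fun r => (2 * p * lam * r / α * M + τ * r ^ α / SNR + |Real.log x|) * fR lam r
    with hb
  have hmom : ∀ s : ℝ, 0 ≤ s → IntegrableOn (fun r => r ^ s * Real.exp (-(2 * lam) * r)) (Ioi 0) :=
    fun s hs => by
      have := integrableOn_rpow_mul_exp_neg_mul_rpow (s := s) (p := 1) (b := 2 * lam)
        (by linarith) one_pos (by linarith)
      simpa using this
  have hbi : IntegrableOn b (Ioi 0) := by
    have : b = fun r => 2 * p * lam / α * M * (2 * lam) * (r ^ (1 : ℝ) * Real.exp (-(2 * lam) * r)) +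
        τ / SNR * (2 * lam) * (r ^ α * Real.exp (-(2 * lam) * r)) +
        |Real.log x| * (2 * lam) * (r ^ (0 : ℝ) * Real.exp (-(2 * lam) * r)) := by
      ext r
      simp only [hb, fR, Real.rpow_one, Real.rpow_zero]
      ring_nf
    rw [this]
    exact (((hmom 1 zero_le_one).const_mul _).add ((hmom α hα0.le).const_mul _)).add
      ((hmom 0 le_rfl).const_mul _)
  refine ⟨∫ r in Ioi 0, b r, fun t ht => ?_⟩
  rw [← integral_mul_const, ← Real.norm_eq_abs]
  refine norm_integral_le_of_norm_le (hbi.mul_const t) ?_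
  filter_upwards [ae_restrict_mem measurableSet_Ioi] with r hr
  have hr : 0 < r := hr
  rw [innerIntegrand, norm_mul, norm_mul, Real.norm_of_nonneg fr_pos.le,
    Real.norm_of_nonneg (fR_nonneg hlam.le), Real.norm_eq_abs, hb]
  have hS := abs_integral_sinKernel_le (t := t) hα hτ
  rw [abs_of_pos ht] at hS
  have hsin : |Real.sin (fi lam p α τ t r + Theta α τ SNR x t r)| ≤
      (2 * p * lam * r / α * M + τ * r ^ α / SNR + |Real.log x|) * t := by
    calc _ ≤ |fi lam p α τ t r + Theta α τ SNR x t r| := Real.abs_sin_le_abs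
      _ ≤ |fi lam p α τ t r| + |Theta α τ SNR x t r| := abs_add_le _ _
      _ ≤ 2 * p * lam * r / α * (t * M) + (|t * τ * r ^ α / SNR| + |t * Real.log x|) := by
          refine add_le_add ?_ (abs_add_le _ _)
          rw [fi, abs_mul, abs_of_nonneg (by positivity : 0 ≤ 2 * p * lam * r / α)]
          gcongr
      _ = _ := by
          rw [abs_of_nonneg (by positivity), abs_mul, abs_of_pos ht]
          ring
  calc _ ≤ 1 * ((2 * p * lam * r / α * M + τ * r ^ α / SNR + |Real.log x|) * t) * fR lam r := by
        refine mul_le_mul_of_nonneg_right ?_ (fR_nonneg hlam.le)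
        exact mul_le_mul (fr_le_one hlam.le hp hα0.le hr.le) hsin (abs_nonneg _) zero_le_one
    _ = _ := by rw [one_mul, mul_right_comm]

lemma integrableOn_outerIntegrand (hlam : 0 < lam) (hp : 0 < p) (hα : 1 < α)
    (hτ : 0 < τ) (hSNR : 0 ≤ SNR) :
    IntegrableOn (outerIntegrand lam p α τ SNR x) (Ioi 0) := by
  have hα0 : 0 < α := by linarith
  rw [← Ioc_union_Ioi_eq_Ioi (zero_le_one' ℝ)]
  refine IntegrableOn.union ?_ ?_
  · obtain ⟨C, hC⟩ := exists_abs_integral_innerIntegrand_le (x := x) hlam hp.le hα hτ.le hSNR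
    refine IntegrableOn.of_bound (by simp) ?_ C ?_
    · exact (stronglyMeasurable_integral_innerIntegrand.measurable.div
        measurable_id).aestronglyMeasurable
    · filter_upwards [ae_restrict_mem measurableSet_Ioc] with t ht
      rw [outerIntegrand, norm_div, Real.norm_of_nonneg ht.1.le, div_le_iff₀ ht.1]
      exact hC t ht.1
  · obtain ⟨C, hC⟩ := exists_integral_fR_mul_fr_le hlam hp hα hτ
    refine integrableOn_div_of_decay hα0 stronglyMeasurable_integral_innerIntegrand fun t ht =>
      le_trans ?_ (hC t ht)
    exact norm_integral_le_of_norm_le (integrableOn_fR_mul_fr hlam hp.le hα0.le)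
      (ae_of_all _ fun r => norm_innerIntegrand_le hlam.le r)

lemma exp_mul_logCharFun (hα : 1 < α) (hτ : 0 ≤ τ) (r : ℝ) :
    Complex.exp (r * logCharFun lam p α τ t) =
      fr lam p α τ t r * Complex.exp (fi lam p α τ t r * Complex.I) := by
  rw [logCharFun_eq lam p hα hτ, fr, Complex.ofReal_exp, ← Complex.exp_add, fi]
  congr 1
  push_cast
  ring

lemma norm_exp_mul_logCharFun_le (hlam : 0 ≤ lam) (hp : 0 ≤ p) (hα : 1 < α) (hτ : 0 ≤ τ) {r : ℝ}
    (hr : 0 ≤ r) : ‖Complex.exp (r * logCharFun lam p α τ t)‖ ≤ 1 := by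
  rw [exp_mul_logCharFun hα hτ, norm_mul, Complex.norm_exp_ofReal_mul_I, mul_one,
    Complex.norm_real, Real.norm_of_nonneg fr_pos.le]
  exact fr_le_one hlam hp (by linarith) hr

end Integrands

/-! ### Averaging over Rayleigh fading for fixed locations. -/

section Fading

variable {Ω : Type*} [MeasurableSpace Ω] {μ : Measure Ω}

lemma integral_exp_neg_mul_expMeasure {s : ℝ} (hs : 0 ≤ s) :
    ∫ x, Real.exp (-(s * x)) ∂(expMeasure 1) = (1 + s)⁻¹ := by
  rw [integral_expMeasure one_pos]
  have h : ∀ x : ℝ, (1 * Real.exp (-(1 * x))) • Real.exp (-(s * x)) = Real.exp (-(1 + s) * x) := by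
    intro x
    rw [smul_eq_mul, one_mul, ← Real.exp_add]
    ring_nf
  simp_rw [h]
  rw [integral_exp_mul_Ioi (by linarith) 0]
  rw [mul_zero, Real.exp_zero, neg_div_neg_eq, one_div]

lemma lintegral_ofReal_expMeasure_ne_top : ∫⁻ x, ENNReal.ofReal x ∂(expMeasure 1) ≠ ∞ := by
  have hd : expMeasure 1 = volume.withDensity (exponentialPDF 1) := rfl
  have hm : Measurable (exponentialPDF 1) := (measurable_exponentialPDFReal 1).ennreal_ofReal
  rw [hd, lintegral_withDensity_eq_lintegral_mul _ hm (by fun_prop)]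
  have hint : IntegrableOn (fun x : ℝ => x ^ (1 : ℝ) * Real.exp (-1 * x ^ (1 : ℝ))) (Ioi 0) :=
    integrableOn_rpow_mul_exp_neg_mul_rpow (by norm_num) one_pos one_pos
  have hfin := hint.lintegral_lt_top.ne
  refine ne_top_of_le_ne_top hfin ?_
  rw [← lintegral_indicator measurableSet_Ioi]
  refine lintegral_mono fun x => ?_
  rcases le_or_gt x 0 with h | h
  · simp [ENNReal.ofReal_of_nonpos h]
  · rw [indicator_of_mem (by exact h), Pi.mul_apply, exponentialPDF_of_nonneg h.le,
      ← ENNReal.ofReal_mul (by positivity)]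
    refine ENNReal.ofReal_le_ofReal (le_of_eq ?_)
    simp [mul_comm]

variable {H : Ω → ℝ} {G : ℕ → Ω → ℝ}

lemma integral_comp_gain {X : Ω → ℝ} (hX : Measurable X) (hl : μ.map X = expMeasure 1) {s : ℝ}
    (hs : 0 ≤ s) : ∫ ω, Real.exp (-(s * X ω)) ∂μ = (1 + s)⁻¹ := by
  rw [← integral_exp_neg_mul_expMeasure hs, ← hl, integral_map hX.aemeasurable
    (Measurable.aestronglyMeasurable (by fun_prop))]

lemma ae_gain_nonneg {X : Ω → ℝ} (hX : Measurable X) (hl : μ.map X = expMeasure 1) :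
    ∀ᵐ ω ∂μ, 0 ≤ X ω := by
  have := isProbabilityMeasure_expMeasure one_pos
  refine ae_of_ae_map (p := fun x => 0 ≤ x) hX.aemeasurable ?_
  change Ici (0 : ℝ) ∈ ae (μ.map X)
  rw [hl, mem_ae_iff_prob_eq_one measurableSet_Ici]
  have := expMeasure_Ici one_pos le_rfl
  simpa [measureReal_def, ENNReal.toReal_eq_one_iff] using this

/-- The expected sum is the mean gain times `∑ b i`, which is finite. -/
lemma ae_tsum_gain_ne_top (hG : ∀ i, Measurable (G i)) (hl : ∀ i, μ.map (G i) = expMeasure 1)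
    {b : ℕ → ℝ} (hb : ∀ i, 0 ≤ b i) (hs : Summable b) :
    ∀ᵐ ω ∂μ, ∑' i, ENNReal.ofReal (G i ω * b i) ≠ ∞ := by
  have hm : ∀ i, Measurable fun ω => ENNReal.ofReal (G i ω * b i) := fun i => by
    have := hG i
    fun_prop
  have hfin : ∫⁻ ω, ∑' i, ENNReal.ofReal (G i ω * b i) ∂μ ≠ ∞ := by
    rw [lintegral_tsum fun i => (hm i).aemeasurable]
    have h : ∀ i, ∫⁻ ω, ENNReal.ofReal (G i ω * b i) ∂μ =
        (∫⁻ x, ENNReal.ofReal x ∂(expMeasure 1)) * ENNReal.ofReal (b i) := fun i => by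
      simp_rw [ENNReal.ofReal_mul' (hb i)]
      rw [lintegral_mul_const _ (hG i).ennreal_ofReal, ← hl i,
        lintegral_map (by fun_prop) (hG i)]
    simp_rw [h]
    rw [ENNReal.tsum_mul_left]
    exact ENNReal.mul_ne_top lintegral_ofReal_expMeasure_ne_top hs.tsum_ofReal_ne_top
  filter_upwards [ae_lt_top (Measurable.tsum hm) hfin] with ω hω using hω.ne

/-- With the interference frozen at `J`, coverage is the event `H > (τ / c)(J + n)`, whose
probability is an exponential tail and splits into noise and interference factors. -/
lemma measureReal_mul_lt_gain (hH : Measurable H) (hl : μ.map H = expMeasure 1) {c τ n : ℝ}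
    (hc : 0 < c) (hτ : 0 < τ) (hn : 0 < n) {J : ℝ≥0∞} (hJ : J ≠ ∞) :
    μ.real {ω | ENNReal.ofReal τ < ENNReal.ofReal (H ω * c) / (J + ENNReal.ofReal n)} =
      Real.exp (-(τ / c * n)) * Real.exp (-(τ / c * J.toReal)) := by
  have hset : {ω | ENNReal.ofReal τ < ENNReal.ofReal (H ω * c) / (J + ENNReal.ofReal n)} =
      H ⁻¹' Ioi (τ / c * (J.toReal + n)) := by
    ext ω
    have hJ' : J + ENNReal.ofReal n = ENNReal.ofReal (J.toReal + n) := by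
      rw [ENNReal.ofReal_add ENNReal.toReal_nonneg hn.le, ENNReal.ofReal_toReal hJ]
    have hpos : 0 < J.toReal + n := add_pos_of_nonneg_of_pos ENNReal.toReal_nonneg hn
    simp only [mem_ofPred_eq, mem_preimage, mem_Ioi]
    rw [hJ', ← ENNReal.ofReal_div_of_pos hpos, ENNReal.ofReal_lt_ofReal_iff_of_nonneg hτ.le,
      lt_div_iff₀ hpos, div_mul_eq_mul_div, div_lt_iff₀ hc]
  have hnn : 0 ≤ τ / c * (J.toReal + n) := by positivity
  rw [hset, ← map_measureReal_apply hH measurableSet_Ioi, hl, expMeasure_Ioi one_pos hnn,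
    ← Real.exp_add]
  ring_nf

variable [IsProbabilityMeasure μ]

/-- Laplace transform of a weighted sum of independent exponential variables. -/
lemma integral_exp_neg_tsum_gain (hG : ∀ i, Measurable (G i))
    (hl : ∀ i, μ.map (G i) = expMeasure 1) (hi : iIndepFun G μ)
    {b : ℕ → ℝ} (hb : ∀ i, 0 ≤ b i) (hs : Summable b) :
    ∫ ω, Real.exp (-(∑' i, ENNReal.ofReal (G i ω * b i)).toReal) ∂μ =
      Real.exp (-∑' i, Real.log (1 + b i)) := by
  have hfinprod : ∀ n, ∫ ω, Real.exp (-∑ i ∈ Finset.range n, G i ω * b i) ∂μ =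
      Real.exp (-∑ i ∈ Finset.range n, Real.log (1 + b i)) := by
    intro n
    have h := (hi.precomp (g := fun i : Finset.range n => (i : ℕ))
      Subtype.val_injective).integral_fun_prod_comp
      (f := fun (i : Finset.range n) (x : ℝ) => Real.exp (-(b i * x)))
      (fun i => (hG i).aemeasurable) (fun i => Measurable.aestronglyMeasurable (by fun_prop))
    have e : ∀ ω, Real.exp (-∑ i ∈ Finset.range n, G i ω * b i) =
        ∏ i : Finset.range n, Real.exp (-(b i * G i ω)) := fun ω => by
      rw [Finset.prod_coe_sort (Finset.range n) fun i => Real.exp (-(b i * G i ω)),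
        ← Real.exp_sum, Finset.sum_neg_distrib]
      simp_rw [mul_comm]
    simp_rw [e]
    rw [h, Finset.prod_coe_sort (Finset.range n) fun i => ∫ ω, Real.exp (-(b i * G i ω)) ∂μ,
      ← Finset.sum_neg_distrib, Real.exp_sum]
    refine Finset.prod_congr rfl fun i _ => ?_
    rw [integral_comp_gain (hG i) (hl i) (hb i), Real.exp_neg, Real.exp_log]
    linarith [hb i]
  have hlog : Summable fun i => Real.log (1 + b i) :=
    Real.summable_log_one_add_of_summable hs
  have l2 : Tendsto (fun n => Real.exp (-∑ i ∈ Finset.range n, Real.log (1 + b i))) atTop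
      (𝓝 (Real.exp (-∑' i, Real.log (1 + b i)))) :=
    (Real.continuous_exp.tendsto _).comp hlog.hasSum.tendsto_sum_nat.neg
  have hnn : ∀ᵐ ω ∂μ, ∀ i, 0 ≤ G i ω := ae_all_iff.2 fun i => ae_gain_nonneg (hG i) (hl i)
  -- The finite product formula passes to the limit: gains are almost surely nonnegative, so the
  -- exponentials are bounded by `1`, and the random series is almost surely finite.
  have l1 : Tendsto (fun n => ∫ ω, Real.exp (-∑ i ∈ Finset.range n, G i ω * b i) ∂μ) atTop
      (𝓝 (∫ ω, Real.exp (-(∑' i, ENNReal.ofReal (G i ω * b i)).toReal) ∂μ)) := by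
    refine tendsto_integral_of_dominated_convergence (fun _ => 1) (fun n => ?_)
      (integrable_const _) (fun n => ?_) ?_
    · exact Measurable.aestronglyMeasurable (by fun_prop)
    · filter_upwards [hnn] with ω hω
      rw [Real.norm_of_nonneg (Real.exp_pos _).le, Real.exp_le_one_iff, neg_nonpos]
      exact Finset.sum_nonneg fun i _ => mul_nonneg (hω i) (hb i)
    · filter_upwards [hnn, ae_tsum_gain_ne_top hG hl hb hs] with ω hω hfin
      refine (Real.continuous_exp.tendsto _).comp (Tendsto.neg ?_)
      have ht := (ENNReal.tendsto_toReal hfin).comp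
        (ENNReal.summable (f := fun i => ENNReal.ofReal (G i ω * b i))).hasSum.tendsto_sum_nat
      refine ht.congr fun n => ?_
      rw [Function.comp_apply, ENNReal.toReal_sum fun i _ => ENNReal.ofReal_ne_top]
      exact Finset.sum_congr rfl fun i _ => ENNReal.toReal_ofReal (mul_nonneg (hω i) (hb i))
  exact tendsto_nhds_unique l1 (l2.congr fun n => (hfinprod n).symm)

/-- Coverage probability under Rayleigh fading for given locations and activities. -/
lemma measureReal_coverage (hH : Measurable H) (hG : ∀ i, Measurable (G i))
    (hHl : μ.map H = expMeasure 1) (hl : ∀ i, μ.map (G i) = expMeasure 1)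
    (hi : iIndepFun (fun o : Option ℕ => o.elim H G) μ) {c τ n : ℝ}
    (hc : 0 < c) (hτ : 0 < τ) (hn : 0 < n) {b : ℕ → ℝ} (hb : ∀ i, 0 ≤ b i) (hs : Summable b) :
    μ.real {ω | ENNReal.ofReal τ < ENNReal.ofReal (H ω * c) /
        ((∑' i, ENNReal.ofReal (G i ω * b i)) + ENNReal.ofReal n)} =
      Real.exp (-(τ / c * n)) * Real.exp (-∑' i, Real.log (1 + τ / c * b i)) := by
  have hGi : iIndepFun G μ := hi.precomp (g := some) (Option.some_injective ℕ)
  have hJm : Measurable fun ω => ∑' i, ENNReal.ofReal (G i ω * b i) :=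
    Measurable.tsum fun i => by have := hG i; fun_prop
  -- The joint family is indexed by `Option ℕ`; the blocks `range some` and `{none}` are disjoint,
  -- so all interfering gains together are independent of the serving one.
  have hGH : IndepFun (fun ω i => G i ω) H μ := by
    have hm : ∀ o : Option ℕ, Measurable (o.elim H G) := fun o => by
      cases o
      · exact hH
      · exact hG _
    have h := indep_iSup_of_disjoint (fun o => (hm o).comap_le) hi
      (S := range some) (T := {none}) (by simp)
    rw [IndepFun_iff_Indep]
    refine indep_of_indep_of_le_left (indep_of_indep_of_le_right h ?_) ?_
    · simp
    · rw [MeasurableSpace.pi, MeasurableSpace.comap_iSup]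
      refine iSup_le fun i => ?_
      rw [MeasurableSpace.comap_comp]
      exact le_iSup₂_of_le (some i) (mem_range_self i) le_rfl
  have hJH : IndepFun (fun ω => ∑' i, ENNReal.ofReal (G i ω * b i)) H μ :=
    hGH.comp (φ := fun g : ℕ → ℝ => ∑' i, ENNReal.ofReal (g i * b i)) (ψ := id)
      (Measurable.tsum fun i => by fun_prop) measurable_id
  set D : Set (ℝ≥0∞ × ℝ) := {q | ENNReal.ofReal τ < ENNReal.ofReal (q.2 * c) /
    (q.1 + ENNReal.ofReal n)} with hD
  have hDm : MeasurableSet D := measurableSet_lt measurable_const (by fun_prop)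
  have hF : StronglyMeasurable (D.indicator fun _ => (1 : ℝ)) :=
    stronglyMeasurable_const.indicator hDm
  have h1 : μ.real {ω | ENNReal.ofReal τ < ENNReal.ofReal (H ω * c) /
        ((∑' i, ENNReal.ofReal (G i ω * b i)) + ENNReal.ofReal n)} =
      ∫ ω, D.indicator (fun _ => (1 : ℝ)) (∑' i, ENNReal.ofReal (G i ω * b i), H ω) ∂μ := by
    rw [← integral_indicator_one]
    · rfl
    · exact (hJm.prodMk hH) hDm
  rw [h1, IndepFun.integral_comp_eq_integral_integral hJH hJm hH hF (C := 1) fun q => by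
    by_cases h : q ∈ D <;> simp [h]]
  have h2 : ∀ᵐ ω ∂μ, ∫ ω', D.indicator (fun _ => (1 : ℝ))
      (∑' i, ENNReal.ofReal (G i ω * b i), H ω') ∂μ = Real.exp (-(τ / c * n)) *
        Real.exp (-(∑' i, ENNReal.ofReal (G i ω * (τ / c * b i))).toReal) := by
    filter_upwards [ae_tsum_gain_ne_top hG hl hb hs] with ω hω
    have e : ∀ i, ENNReal.ofReal (G i ω * (τ / c * b i)) =
        ENNReal.ofReal (τ / c) * ENNReal.ofReal (G i ω * b i) := fun i => by
      rw [← ENNReal.ofReal_mul (by positivity)]; ring_nf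
    simp_rw [e]
    rw [ENNReal.tsum_mul_left, ENNReal.toReal_mul, ENNReal.toReal_ofReal (by positivity),
      ← measureReal_mul_lt_gain hH hHl hc hτ hn hω, ← integral_indicator_one]
    · rfl
    · exact (measurable_const.prodMk hH) hDm
  rw [integral_congr_ae h2, integral_const_mul, integral_exp_neg_tsum_gain hG hl hGi
    (fun i => by have := hb i; positivity) (hs.mul_left _)]

end Fading

/-! ### Identification of the conditional coverage probability. -/

section ConditionalCoverage

variable {Ω : Type*} {lam p α Pt noise τ : ℝ} {z : ℕ → Ω → ℝ} {act : ℕ → Ω → Bool}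
  {H : Ω → ℝ} {G : ℕ → Ω → ℝ}

/-- Closed form of the conditional coverage probability. -/
def coverageFormula (α Pt noise τ : ℝ) (z : ℕ → Ω → ℝ) (act : ℕ → Ω → Bool) (r : ℝ) (ω : Ω) : ℝ :=
  Real.exp (-(τ * noise / Pt * r ^ α)) * Real.exp (-(logLoss α τ z act r ω).toReal)

lemma measurable_SINR [MeasurableSpace Ω] (hz : ∀ i, Measurable (z i))
    (ha : ∀ i, Measurable (act i)) (hH : Measurable H) (hG : ∀ i, Measurable (G i)) :
    Measurable (SINR α Pt noise z act H G) := by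
  have hR := measurable_servingDist hz
  have hI : Measurable (interference α Pt z act G) := by
    refine Measurable.tsum fun i => Measurable.ite ?_ ?_ measurable_const
    · exact (ha i (measurableSet_singleton true)).inter (measurableSet_lt hR (hz i).abs)
    · have h1 := hz i
      have h2 := hG i
      have h3 := h1.abs
      fun_prop
  unfold SINR
  fun_prop

/-- The locations and the activities of all RSUs. -/
def configuration (z : ℕ → Ω → ℝ) (act : ℕ → Ω → Bool) (ω : Ω) : (ℕ → ℝ) × (ℕ → Bool) :=
  (fun i => z i ω, fun i => act i ω)

/-- All fading gains. -/
def fading (H : Ω → ℝ) (G : ℕ → Ω → ℝ) (ω : Ω) : ℝ × (ℕ → ℝ) := (H ω, fun i => G i ω)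

/-- The SINR as a function of the configuration and of the fading gains. -/
def coordSINR (α Pt noise : ℝ) (q : ((ℕ → ℝ) × (ℕ → Bool)) × (ℝ × (ℕ → ℝ))) : ℝ≥0∞ :=
  SINR α Pt noise (fun i q => q.1.1 i) (fun i q => q.1.2 i) (fun q => q.2.1) (fun i q => q.2.2 i) q

lemma measurable_coordSINR : Measurable (coordSINR α Pt noise) :=
  measurable_SINR (fun _ => by fun_prop) (fun _ => by fun_prop) (by fun_prop) (fun _ => by fun_prop)

/-- Holds by definition: `coordSINR` is the SINR of the coordinate processes. Using different
samples `ω` and `ω'` freezes the network while the fading is redrawn. -/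
lemma coordSINR_eq (ω ω' : Ω) : coordSINR α Pt noise (configuration z act ω, fading H G ω') =
    ENNReal.ofReal (H ω' * Pt * servingDist z ω ^ (-α)) /
      ((∑' i, if act i ω = true ∧ servingDist z ω < |z i ω| then
        ENNReal.ofReal (G i ω' * Pt * |z i ω| ^ (-α)) else 0) + ENNReal.ofReal noise) := rfl

section

variable [MeasurableSpace Ω] {μ : Measure Ω}

lemma IsNetwork.measurable_configuration (hnet : IsNetwork μ lam p z act H G) :
    Measurable (configuration z act) :=
  (measurable_pi_lambda _ hnet.measurable_loc).prodMk (measurable_pi_lambda _ hnet.measurable_act)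

lemma IsNetwork.measurable_fading (hnet : IsNetwork μ lam p z act H G) :
    Measurable (fading H G) :=
  hnet.measurable_serving_gain.prodMk (measurable_pi_lambda _ hnet.measurable_gain)

lemma IsNetwork.realization_le (hnet : IsNetwork μ lam p z act H G) :
    realization z act ≤ ‹MeasurableSpace Ω› :=
  sup_le hnet.measurable_servingDist.comap_le
    (measurable_activeProcess hnet.measurable_loc hnet.measurable_act).comap_le

-- Every event of the realization is thus a preimage under `configuration`, which lets the defining
-- property of the conditional expectation be tested by Fubini over configuration and fading.
omit [MeasurableSpace Ω] in
lemma realization_le_comap_configuration :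
    realization z act ≤ MeasurableSpace.comap (configuration z act) inferInstance := by
  refine sup_le ?_ ?_
  · have h : Measurable (servingDist fun i (q : (ℕ → ℝ) × (ℕ → Bool)) => q.1 i) :=
      measurable_servingDist fun i => by fun_prop
    have e : servingDist z = servingDist (fun i (q : (ℕ → ℝ) × (ℕ → Bool)) => q.1 i) ∘
        configuration z act := rfl
    rw [e, ← MeasurableSpace.comap_comp]
    exact MeasurableSpace.comap_mono h.comap_le
  · have h : Measurable (activeProcess (fun i (q : (ℕ → ℝ) × (ℕ → Bool)) => q.1 i)
        fun i q => q.2 i) :=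
      measurable_activeProcess (fun i => by fun_prop) fun i => by fun_prop
    have e : activeProcess z act = activeProcess (fun i (q : (ℕ → ℝ) × (ℕ → Bool)) => q.1 i)
        (fun i q => q.2 i) ∘ configuration z act := rfl
    rw [e, ← MeasurableSpace.comap_comp]
    exact MeasurableSpace.comap_mono h.comap_le

lemma IsNetwork.measurable_coverageFormula (hnet : IsNetwork μ lam p z act H G) {r : Ω → ℝ}
    (hr : Measurable r) : Measurable fun ω => coverageFormula α Pt noise τ z act (r ω) ω := by
  have := hnet.measurable_logLoss (α := α) (τ := τ) hr
  unfold coverageFormula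
  fun_prop

variable [IsProbabilityMeasure μ]

/-- Locations are independent of the pair of activities and fading, and these two are independent of
each other; the joint law is a triple product, which is reassociated. -/
lemma IsNetwork.indep_configuration_fading (hnet : IsNetwork μ lam p z act H G) :
    IndepFun (configuration z act) (fading H G) μ := by
  have hz : Measurable fun ω i => z i ω := measurable_pi_lambda _ hnet.measurable_loc
  have ha : Measurable fun ω i => act i ω := measurable_pi_lambda _ hnet.measurable_act
  have hf := hnet.measurable_fading
  have hc := hnet.measurable_configuration
  have := Measure.isProbabilityMeasure_map hz.aemeasurable (μ := μ)
  have := Measure.isProbabilityMeasure_map ha.aemeasurable (μ := μ)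
  have := Measure.isProbabilityMeasure_map hf.aemeasurable (μ := μ)
  have h1 := (indepFun_iff_map_prod_eq_prod_map_map hz.aemeasurable
    (ha.prodMk hf).aemeasurable).1 hnet.indep_loc_marks
  have h2 := (indepFun_iff_map_prod_eq_prod_map_map ha.aemeasurable
    hf.aemeasurable).1 hnet.indep_act_gain
  have h3 := (indepFun_iff_map_prod_eq_prod_map_map hz.aemeasurable
    ha.aemeasurable).1 hnet.indep_loc_act
  refine (indepFun_iff_map_prod_eq_prod_map_map hc.aemeasurable hf.aemeasurable).2 ?_
  have h4 : μ.map (configuration z act) =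
      (μ.map fun ω i => z i ω).prod (μ.map fun ω i => act i ω) := h3
  rw [h4]
  refine (MeasurableEquiv.prodAssoc (α := ℕ → ℝ) (β := ℕ → Bool)
    (γ := ℝ × (ℕ → ℝ))).map_measurableEquiv_injective ?_
  rw [Measure.prodAssoc_prod, Measure.map_map (by fun_prop) (hc.prodMk hf), ← h2]
  exact h1

lemma IsNetwork.ae_measureReal_coordSINR (hnet : IsNetwork μ lam p z act H G) (hlam : 0 < lam)
    (hp : 0 ≤ p) (hα : 1 < α) (hPt : 0 < Pt) (hnoise : 0 < noise) (hτ : 0 < τ) :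
    ∀ᵐ ω ∂μ, μ.real {ω' | ENNReal.ofReal τ <
      coordSINR α Pt noise (configuration z act ω, fading H G ω')} =
        coverageFormula α Pt noise τ z act (servingDist z ω) ω := by
  filter_upwards [hnet.ae_servingDist_pos hlam hp, hnet.ae_tailLoss hα] with ω hR htail
  set R := servingDist z ω with hRdef
  -- Mean received powers of the interferers. Relative to the serving power `Pt * R ^ (-α)`, the
  -- weight `τ / c * b i` is `τ R ^ α |z i| ^ (-α)`, the argument in `pathLoss`.
  set b : ℕ → ℝ := fun i => if act i ω = true ∧ R < |z i ω| then Pt * |z i ω| ^ (-α) else 0 with hb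
  have hb0 : ∀ i, 0 ≤ b i := fun i => by simp only [hb]; split_ifs <;> positivity
  have htl : Summable fun i => tailLoss α R (z i ω) := by
    have h := htail R hR
    rw [rsuProcess, lintegral_sum_measure] at h
    simp only [lintegral_dirac] at h
    simpa [ENNReal.toReal_ofReal tailLoss_nonneg] using ENNReal.summable_toReal h
  have hbs : Summable b := by
    refine Summable.of_nonneg_of_le hb0 (fun i => ?_) (htl.mul_left Pt)
    simp only [hb]
    split_ifs with h
    · rw [tailLoss, if_pos h.2]
    · exact mul_nonneg hPt.le tailLoss_nonneg
  have hc : 0 < Pt * R ^ (-α) := by positivity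
  have hset : {ω' | ENNReal.ofReal τ <
      coordSINR α Pt noise (configuration z act ω, fading H G ω')} =
      {ω' | ENNReal.ofReal τ < ENNReal.ofReal (H ω' * (Pt * R ^ (-α))) /
        ((∑' i, ENNReal.ofReal (G i ω' * b i)) + ENNReal.ofReal noise)} := by
    ext ω'
    simp only [mem_ofPred_eq, coordSINR_eq, ← hRdef, mul_assoc]
    have e : ∀ i, (if act i ω = true ∧ R < |z i ω| then
        ENNReal.ofReal (G i ω' * (Pt * |z i ω| ^ (-α))) else 0) =
        ENNReal.ofReal (G i ω' * b i) := fun i => by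
      simp only [hb]; split_ifs <;> simp
    simp_rw [e]
  have hdiv : τ / (Pt * R ^ (-α)) = τ / Pt * R ^ α := by
    rw [Real.rpow_neg hR.le]; field_simp
  rw [hset, measureReal_coverage hnet.measurable_serving_gain hnet.measurable_gain
    hnet.serving_gain_law hnet.gain_law hnet.indep_gain hc hτ hnoise hb0 hbs, coverageFormula, hdiv]
  congr 3
  · ring
  · rw [logLoss, lintegral_activeProcess, ENNReal.tsum_toReal_eq fun i => by split_ifs <;> simp]
    refine tsum_congr fun i => ?_
    simp only [hb]
    by_cases ha : act i ω = true
    · rw [if_pos ha, ENNReal.toReal_ofReal (pathLoss_nonneg hτ.le), pathLoss_div_eq hR]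
      by_cases hlt : R < |z i ω|
      · rw [if_pos ⟨ha, hlt⟩, if_pos hlt]
        congr 2
        field_simp
      · simp [hlt]
    · simp [ha]

omit [MeasurableSpace Ω] in
lemma coverageFormula_nonneg {r : ℝ} {ω : Ω} : 0 ≤ coverageFormula α Pt noise τ z act r ω := by
  unfold coverageFormula; positivity

omit [MeasurableSpace Ω] in
lemma coverageFormula_le_one (hPt : 0 ≤ Pt) (hnoise : 0 ≤ noise) (hτ : 0 ≤ τ) {r : ℝ} (hr : 0 ≤ r)
    {ω : Ω} : coverageFormula α Pt noise τ z act r ω ≤ 1 := by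
  refine mul_le_one₀ (Real.exp_le_one_iff.2 (neg_nonpos.2 (by positivity))) (Real.exp_pos _).le
    (Real.exp_le_one_iff.2 (neg_nonpos.2 ENNReal.toReal_nonneg))

-- For a fixed function, its integral is measurable in the measure. As `gridAbove` takes countably
-- many values, the joint dependence on `R` and on the active process reduces to countably many such
-- functions.
omit [MeasurableSpace Ω] in
lemma measurable_coverageFormula_gridAbove (n : ℕ) : Measurable[realization z act]
    fun ω => coverageFormula α Pt noise τ z act (gridAbove n (servingDist z ω)) ω := by
  let _ : MeasurableSpace Ω := realization z act
  have hR : Measurable (servingDist z) := (comap_measurable _).mono le_sup_left le_rfl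
  have hA : Measurable (activeProcess z act) := (comap_measurable _).mono le_sup_right le_rfl
  have hg := (measurable_gridAbove n).comp hR
  have hΦ : Measurable fun q : ℕ × Measure ℝ => ∫⁻ y, ENNReal.ofReal
      (pathLoss α τ (y / ((q.1 + 1) / (n + 1)))) ∂q.2 := by
    refine measurable_from_prod_countable_right fun k => ?_
    have hf : Measurable fun y => ENNReal.ofReal
        (pathLoss α τ (y / (((k : ℝ) + 1) / (n + 1)))) :=
      (measurable_pathLoss.comp (by fun_prop)).ennreal_ofReal
    exact Measure.measurable_lintegral hf
  have hk : Measurable fun ω => ⌊((n : ℝ) + 1) * servingDist z ω⌋₊ :=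
    Nat.measurable_floor.comp (hR.const_mul _)
  have hL : Measurable fun ω => logLoss α τ z act (gridAbove n (servingDist z ω)) ω :=
    hΦ.comp (hk.prodMk hA)
  simp only [Function.comp_def] at hg
  unfold coverageFormula
  fun_prop

/-- The grid approximants are measurable for the realization and converge almost surely; their
`limsup` is a measurable version everywhere defined. -/
lemma IsNetwork.aestronglyMeasurable_coverageFormula (hnet : IsNetwork μ lam p z act H G)
    (hlam : 0 < lam) (hp : 0 ≤ p) (hα : 1 < α) (hτ : 0 ≤ τ) :
    AEStronglyMeasurable[realization z act]
      (fun ω => coverageFormula α Pt noise τ z act (servingDist z ω) ω) μ := by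
  refine ⟨fun ω => limsup (fun n =>
    coverageFormula α Pt noise τ z act (gridAbove n (servingDist z ω)) ω) atTop, ?_, ?_⟩
  · exact (Measurable.limsup fun n => measurable_coverageFormula_gridAbove n).stronglyMeasurable
  · filter_upwards [hnet.tendsto_logLoss_gridAbove hlam hp hα hτ] with ω hω
    refine (Tendsto.limsup_eq (Tendsto.mul ?_ ?_)).symm
    · refine (Real.continuous_exp.tendsto _).comp (Tendsto.neg (Tendsto.const_mul _ ?_))
      exact (tendsto_gridAbove (servingDist_nonneg ω)).rpow_const (Or.inr (by linarith))
    · exact (Real.continuous_exp.tendsto _).comp ((ENNReal.tendsto_toReal hω.1).comp hω.2).neg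

/-- The conditional coverage probability in closed form. -/
lemma IsNetwork.condCoverage_ae_eq (hnet : IsNetwork μ lam p z act H G) (hlam : 0 < lam)
    (hp : 0 ≤ p) (hα : 1 < α) (hPt : 0 < Pt) (hnoise : 0 < noise) (hτ : 0 < τ) :
    (fun ω => coverageFormula α Pt noise τ z act (servingDist z ω) ω) =ᵐ[μ]
      condCoverage μ α Pt noise τ z act H G := by
  have hE : MeasurableSet {ω | ENNReal.ofReal τ < SINR α Pt noise z act H G ω} :=
    measurableSet_lt measurable_const (measurable_SINR hnet.measurable_loc hnet.measurable_act
      hnet.measurable_serving_gain hnet.measurable_gain)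
  have hcf := hnet.measurable_coverageFormula (α := α) (Pt := Pt) (noise := noise) (τ := τ)
    hnet.measurable_servingDist
  have hint : Integrable (fun ω => coverageFormula α Pt noise τ z act (servingDist z ω) ω) μ :=
    Integrable.of_bound hcf.aestronglyMeasurable 1 (ae_of_all _ fun ω => by
      rw [Real.norm_of_nonneg coverageFormula_nonneg]
      exact coverageFormula_le_one hPt.le hnoise.le hτ.le (servingDist_nonneg ω))
  refine ae_eq_condExp_of_forall_setIntegral_eq hnet.realization_le
    ((integrable_const _).indicator hE) (fun s _ _ => hint.integrableOn) (fun s hs _ => ?_)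
    (hnet.aestronglyMeasurable_coverageFormula hlam hp hα hτ.le)
  obtain ⟨S, hS, rfl⟩ := realization_le_comap_configuration s hs
  have hW := hnet.measurable_configuration
  have hV := hnet.measurable_fading
  set D : Set (((ℕ → ℝ) × (ℕ → Bool)) × (ℝ × (ℕ → ℝ))) :=
    {q | ENNReal.ofReal τ < coordSINR α Pt noise q} with hD
  have hDm : MeasurableSet D := measurableSet_lt measurable_const measurable_coordSINR
  have hSm : MeasurableSet (Prod.fst ⁻¹' S ∩ D) := (measurable_fst hS).inter hDm
  have hF : StronglyMeasurable ((Prod.fst ⁻¹' S ∩ D).indicator fun _ => (1 : ℝ)) :=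
    stronglyMeasurable_const.indicator hSm
  have hrhs : ∫ ω in configuration z act ⁻¹' S,
      {ω | ENNReal.ofReal τ < SINR α Pt noise z act H G ω}.indicator (fun _ => (1 : ℝ)) ω ∂μ =
      ∫ ω, (Prod.fst ⁻¹' S ∩ D).indicator (fun _ => (1 : ℝ))
        (configuration z act ω, fading H G ω) ∂μ := by
    rw [← integral_indicator (hW hS), indicator_indicator]
    rfl
  rw [hrhs, IndepFun.integral_comp_eq_integral_integral hnet.indep_configuration_fading hW hV hF
    (C := 1) fun q => by by_cases h : q ∈ Prod.fst ⁻¹' S ∩ D <;> simp [h],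
    ← integral_indicator (hW hS)]
  -- With the configuration frozen, the inner average over fading is `coverageFormula` when the
  -- configuration lies in `S` and `0` otherwise.
  refine integral_congr_ae ?_
  filter_upwards [hnet.ae_measureReal_coordSINR hlam hp hα hPt hnoise hτ] with ω hω
  by_cases h : configuration z act ω ∈ S
  · rw [indicator_of_mem (by exact h), ← hω, ← integral_indicator_one]
    · refine integral_congr_ae (ae_of_all _ fun ω' => ?_)
      simp [indicator, h, hD]
    · exact (measurable_const.prodMk hV) hDm
  · rw [indicator_of_notMem (by exact h)]
    simp [indicator, h]

end

end ConditionalCoverage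

/-! ### Characteristic function of the log-ratio and the inversion formula. -/

section MetaDistribution

variable {Ω : Type*} {lam p α Pt noise τ x : ℝ} {z : ℕ → Ω → ℝ} {act : ℕ → Ω → Bool}
  {H : Ω → ℝ} {G : ℕ → Ω → ℝ}

/-- `log (x / P_c)`. -/
def logRatio (α Pt noise τ x : ℝ) (z : ℕ → Ω → ℝ) (act : ℕ → Ω → Bool) (ω : Ω) : ℝ :=
  τ * noise / Pt * servingDist z ω ^ α + (logLoss α τ z act (servingDist z ω) ω).toReal + Real.log x

lemma lt_coverageFormula_iff (hx : 0 < x) (ω : Ω) :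
    x < coverageFormula α Pt noise τ z act (servingDist z ω) ω ↔
      logRatio α Pt noise τ x z act ω < 0 := by
  rw [coverageFormula, ← Real.exp_add, ← Real.log_lt_iff_lt_exp hx, logRatio]
  constructor <;> intro h <;> linarith

variable [MeasurableSpace Ω] {μ : Measure Ω}

lemma IsNetwork.measurable_logRatio (hnet : IsNetwork μ lam p z act H G) :
    Measurable (logRatio α Pt noise τ x z act) := by
  have h1 := hnet.measurable_logLoss (α := α) (τ := τ) hnet.measurable_servingDist
  have h2 := hnet.measurable_servingDist
  unfold logRatio
  fun_prop

variable [IsProbabilityMeasure μ]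

/-- Characteristic function of the logarithm of the conditional coverage probability. -/
lemma IsNetwork.integral_exp_logRatio (hnet : IsNetwork μ lam p z act H G)
    (hlam : 0 < lam) (hp : 0 ≤ p) (hα : 1 < α) (hτ : 0 ≤ τ)
    (t : ℝ) :
    ∫ ω, Complex.exp ((t * logRatio α Pt noise τ x z act ω : ℝ) * Complex.I) ∂μ =
      ∫ r in Ioi 0, ((fR lam r * fr lam p α τ t r : ℝ) : ℂ) *
        Complex.exp ((fi lam p α τ t r + Theta α τ (Pt / noise) x t r : ℝ) * Complex.I) := by
  -- The part of the characteristic function that depends on the serving distance alone: noise and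
  -- threshold. It supplies the phase `Theta`.
  set h : ℝ → ℂ := fun r =>
    Complex.exp ((t * (τ * noise / Pt * r ^ α + Real.log x) : ℝ) * Complex.I) with hh
  have hhm : Measurable h := by fun_prop
  have hhc : ContinuousOn h (Ioi 0) := by
    have : ContinuousOn (fun r : ℝ => r ^ α) (Ioi 0) := fun r hr =>
      (Real.continuousAt_rpow_const r α (Or.inl (ne_of_gt hr))).continuousWithinAt
    fun_prop
  have hc : ∀ r : ℝ, 0 ≤ r → ‖Complex.exp (r * logCharFun lam p α τ t)‖ ≤ 1 := fun r hr =>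
    norm_exp_mul_logCharFun_le hlam.le hp hα hτ hr
  have e1 : ∀ ω, Complex.exp ((t * logRatio α Pt noise τ x z act ω : ℝ) * Complex.I) =
      h (servingDist z ω) * Complex.exp
        (t * (logLoss α τ z act (servingDist z ω) ω).toReal * Complex.I) := fun ω => by
    rw [hh, ← Complex.exp_add, logRatio]
    congr 1
    push_cast
    ring
  simp_rw [e1]
  rw [hnet.integral_mul_exp_logLoss hlam hp hα hτ t hhc hhm
    (fun r => (Complex.norm_exp_ofReal_mul_I _).le) hc,
    hnet.integral_comp_servingDist hlam hp
      (F := fun r => h r * Complex.exp (r * logCharFun lam p α τ t))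
      (Measurable.stronglyMeasurable (by fun_prop))]
  refine integral_congr_ae (ae_of_all _ fun r => ?_)
  simp only
  rw [exp_mul_logCharFun hα hτ, Complex.real_smul, mul_left_comm (h r), Complex.ofReal_mul,
    mul_assoc, hh, ← Complex.exp_add, Theta]
  congr 3
  push_cast
  field_simp
  ring

lemma integrable_exp_ofReal_mul_I {Y : Ω → ℝ} (hY : Measurable Y) :
    Integrable (fun ω => Complex.exp (Y ω * Complex.I)) μ :=
  Integrable.of_bound (Measurable.aestronglyMeasurable (by fun_prop)) 1
    (ae_of_all _ fun ω => (Complex.norm_exp_ofReal_mul_I _).le)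

lemma IsNetwork.integral_sin_logRatio (hnet : IsNetwork μ lam p z act H G)
    (hlam : 0 < lam) (hp : 0 ≤ p) (hα : 1 < α) (hτ : 0 ≤ τ)
    (t : ℝ) :
    ∫ ω, Real.sin (t * logRatio α Pt noise τ x z act ω) ∂μ =
      ∫ r in Ioi 0, innerIntegrand lam p α τ (Pt / noise) x t r := by
  have hY := (hnet.measurable_logRatio (α := α) (Pt := Pt) (noise := noise) (τ := τ)
    (x := x)).const_mul t
  have h := congrArg Complex.im
    (hnet.integral_exp_logRatio (Pt := Pt) (noise := noise) (x := x) hlam hp hα hτ t)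
  have hint : IntegrableOn (fun r => ((fR lam r * fr lam p α τ t r : ℝ) : ℂ) *
      Complex.exp ((fi lam p α τ t r + Theta α τ (Pt / noise) x t r : ℝ) * Complex.I))
      (Ioi 0) := by
    refine (integrableOn_fR_mul_fr hlam hp (by linarith : 0 ≤ α) (τ := τ) (t := t)).mono' ?_
      (ae_of_all _ fun r => ?_)
    · have h1 := measurable_fR (lam := lam)
      have h2 := (measurable_fr (lam := lam) (p := p) (α := α) (τ := τ)).of_uncurry_left (x := t)
      have h3 := (measurable_fi (lam := lam) (p := p) (α := α) (τ := τ)).of_uncurry_left (x := t)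
      have h4 := (measurable_Theta (α := α) (τ := τ) (SNR := Pt / noise)
        (x := x)).of_uncurry_left (x := t)
      exact Measurable.aestronglyMeasurable (by fun_prop)
    · rw [norm_mul, Complex.norm_exp_ofReal_mul_I, mul_one, Complex.norm_real,
        Real.norm_of_nonneg (mul_nonneg (fR_nonneg hlam.le) fr_pos.le)]
  rw [← RCLike.im_eq_complex_im, ← integral_im (integrable_exp_ofReal_mul_I hY),
    ← integral_im hint] at h
  simp only [RCLike.im_eq_complex_im, Complex.exp_ofReal_mul_I_im, Complex.im_ofReal_mul] at h
  rw [h]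
  refine integral_congr_ae (ae_of_all _ fun r => ?_)
  simp only [innerIntegrand]
  ring

/-- The characteristic function is bounded by the average of `fr`, hence is `O(t ^ (-1/α))`; this
excludes an atom of `logRatio` at `0`. -/
lemma IsNetwork.integrableOn_integral_cos_logRatio (hnet : IsNetwork μ lam p z act H G)
    (hlam : 0 < lam) (hp : 0 < p) (hα : 1 < α) (hτ : 0 < τ) :
    IntegrableOn (fun t => (∫ ω, Real.cos (t * logRatio α Pt noise τ x z act ω) ∂μ) / t)
      (Ioi 1) := by
  have hY := hnet.measurable_logRatio (α := α) (Pt := Pt) (noise := noise) (τ := τ) (x := x)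
  obtain ⟨C, hC⟩ := exists_integral_fR_mul_fr_le hlam hp hα hτ
  refine integrableOn_div_of_decay (by linarith : 0 < α) ?_ fun t ht => le_trans ?_ (hC t ht)
  · refine StronglyMeasurable.integral_prod_right
      (f := fun (t : ℝ) ω => Real.cos (t * logRatio α Pt noise τ x z act ω)) ?_
    exact Measurable.stronglyMeasurable (by fun_prop)
  · have h1 : ∫ ω, Real.cos (t * logRatio α Pt noise τ x z act ω) ∂μ = (∫ ω, Complex.exp
        ((t * logRatio α Pt noise τ x z act ω : ℝ) * Complex.I) ∂μ).re := by
      rw [← RCLike.re_eq_complex_re, ← integral_re (integrable_exp_ofReal_mul_I (hY.const_mul t))]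
      simp only [RCLike.re_eq_complex_re, Complex.exp_ofReal_mul_I_re]
    rw [h1, hnet.integral_exp_logRatio hlam hp.le hα hτ.le]
    refine (Complex.abs_re_le_norm _).trans (norm_integral_le_of_norm_le
      (integrableOn_fR_mul_fr hlam hp.le (by linarith : 0 ≤ α)) (ae_of_all _ fun r => ?_))
    rw [norm_mul, Complex.norm_exp_ofReal_mul_I, mul_one, Complex.norm_real,
      Real.norm_of_nonneg (mul_nonneg (fR_nonneg hlam.le) fr_pos.le)]

lemma IsNetwork.metaDistribution_eq (hnet : IsNetwork μ lam p z act H G)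
    (hlam : 0 < lam) (hp : 0 < p) (hα : 1 < α) (hPt : 0 < Pt) (hnoise : 0 < noise) (hτ : 0 < τ)
    (hx : 0 < x) :
    metaDistribution μ α Pt noise τ z act H G x =
      1 / 2 - (1 / Real.pi) *
        ∫ t in Ioi (0 : ℝ), outerIntegrand lam p α τ (Pt / noise) x t := by
  have hY := hnet.measurable_logRatio (α := α) (Pt := Pt) (noise := noise) (τ := τ) (x := x)
  have h0 := measure_eq_zero_of_integrableOn_cos hY
    (hnet.integrableOn_integral_cos_logRatio hlam hp hα hτ)
  have hsin := fun t =>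
    hnet.integral_sin_logRatio (Pt := Pt) (noise := noise) (x := x) hlam hp.le hα hτ.le t
  have hint := integrableOn_outerIntegrand (x := x) hlam hp hα hτ (div_pos hPt hnoise).le
  have hGP := integral_integral_sin_div hY h0 (by simp only [hsin]; exact hint)
  have hmeta : metaDistribution μ α Pt noise τ z act H G x =
      μ.real {ω | logRatio α Pt noise τ x z act ω < 0} := by
    refine measureReal_congr ?_
    filter_upwards [hnet.condCoverage_ae_eq hlam hp.le hα hPt hnoise hτ] with ω hω
    refine propext ?_
    change x < condCoverage μ α Pt noise τ z act H G ω ↔ logRatio α Pt noise τ x z act ω < 0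
    rw [← hω, lt_coverageFormula_iff hx]
  simp only [hsin] at hGP
  have hGP' : ∫ t in Ioi (0 : ℝ), outerIntegrand lam p α τ (Pt / noise) x t =
      Real.pi / 2 * (1 - 2 * μ.real {ω | logRatio α Pt noise τ x z act ω < 0}) := hGP
  rw [hmeta, hGP']
  field_simp
  ring

end MetaDistribution

end RSUCoverage

end

theorem theorem10 {Ω : Type*} [MeasurableSpace Ω] (μ : Measure Ω) [IsProbabilityMeasure μ]
    (lam p α Pt noise τ x : ℝ) (hlam : 0 < lam) (hp0 : 0 < p) (hp1 : p ≤ 1) (hα : 1 < α)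
    (hPt : 0 < Pt) (hnoise : 0 < noise) (hτ : 0 < τ) (hx : 0 < x)
    (z : ℕ → Ω → ℝ) (act : ℕ → Ω → Bool) (H : Ω → ℝ) (G : ℕ → Ω → ℝ)
    (hnet : RSUCoverage.IsNetwork μ lam p z act H G) :
    (∀ t : ℝ, 0 < t →
      IntervalIntegrable (RSUCoverage.cosKernel α τ t) volume 0 1 ∧
      IntervalIntegrable (RSUCoverage.sinKernel α τ t) volume 0 1 ∧
      IntegrableOn (RSUCoverage.innerIntegrand lam p α τ (Pt / noise) x t) (Ioi 0)) ∧
    IntegrableOn (RSUCoverage.outerIntegrand lam p α τ (Pt / noise) x) (Ioi 0) ∧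
    RSUCoverage.metaDistribution μ α Pt noise τ z act H G x =
      1 / 2 - (1 / Real.pi) *
        ∫ t in Ioi (0 : ℝ), RSUCoverage.outerIntegrand lam p α τ (Pt / noise) x t := by
  refine ⟨fun t _ => ⟨?_, ?_, ?_⟩, ?_, ?_⟩
  · rw [intervalIntegrable_iff_integrableOn_Ioc_of_le zero_le_one]
    exact RSUCoverage.integrableOn_cosKernel hα hτ.le
  · rw [intervalIntegrable_iff_integrableOn_Ioc_of_le zero_le_one]
    exact RSUCoverage.integrableOn_sinKernel hα hτ.le
  · exact RSUCoverage.integrableOn_innerIntegrand hlam hp0.le (by linarith)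
  · exact RSUCoverage.integrableOn_outerIntegrand hlam hp0 hα hτ (div_pos hPt hnoise).le
  · exact hnet.metaDistribution_eq hlam hp0 hα hPt hnoise hτ hx
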